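/- Let $\Lambda$ be a complete noetherian local ring with residue field $k$. Let $C_\Lambda$ be the category of Artin local $\Lambda$-algebras with residue field $k$, and $\widehat C_\Lambda$ the category of complete noetherian local $\Lambda$-algebras with residue field $k$. For a functor $F\colon C_\Lambda\to\mathrm{Sets}$ and $S\in\widehat C_\Lambda$ put $F(S)=\varprojlim_n F(S/\mathfrak m_S^n)$. Let $A[\epsilon]=A[x]/(x^2)$, where $\epsilon$ is the class of $x$. Suppose that $F$ has the tangent lifting property: for all $A\in C_\Lambda$ the natural map $F(A[\epsilon])\to F(A)\times F(k[\epsilon])$ is surjective. Let $R\in\widehat C_\Lambda$ be a hull of $F$, i.e. there is a natural transformation $h_R=\mathrm{Hom}_\Lambda(R,-)\to F$ on $C_\Lambda$ that is smooth (for every surjection $B\to A$ in $C_\Lambda$ the map $h_R(B)\to h_R(A)\times_{F(A)}F(B)$ is surjective) and bijective on $k[\epsilon]$. "Formally smooth" refers to the $\mathfrak m_R$-adic topology on $R$. (i) If $\Lambda$ contains $\mathbb Q$, then $R$ is formally smooth over the image of $\Lambda$ in $R$. In particular, if $\Lambda\to R$ is injective (for instance if $\Lambda=k$), then $R$ is formally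 smooth over $\Lambda$. (ii) If $\Lambda=k$ is a field of characteristic $p>0$, then there are $n,r\ge 0$ and power series $g_1,\dots,g_r\in k[[x_1,\dots,x_n]]$ such that the $f_i=g_i(x_1^p,\dots,x_n^p)$ lie in the maximal ideal and $R\cong k[[x_1,\dots,x_n]]/(f_1,\dots,f_r)$ as $k$-algebras. Moreover, if $k$ is perfect and $\operatorname{Spec}R$ is generically reduced, then $R$ is formally smooth over $k$. (iii) If $\Lambda$ is torsion-free (as an abelian group) and there is an injective local homomorphism $\Lambda\to\Lambda_1$ with $\Lambda_1\in\widehat C_\Lambda$ and $F(\Lambda_1)\neq\emptyset$, then $R$ is formally smooth over $\Lambda$. -/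

import Mathlib

universe u w

namespace TangentLifting

open IsLocalRing CategoryTheory

/-- `A` has the same residue field as `Λ`: the map `Λ → A ⧸ 𝔪_A` is surjective. As `Λ` is local,
the kernel of that map is then `𝔪_Λ`, so that `Λ → A` is local and induces an isomorphism of
residue fields (see `isLocalHom_algebraMap` and `ker_residue` below). -/
class SameResidueField (Λ : Type*) (A : Type*) [CommRing Λ] [IsLocalRing Λ] [CommRing A]
    [IsLocalRing A] [Algebra Λ A] : Prop where
  surj : Function.Surjective (algebraMap Λ (ResidueField A))

section basic

variable (Λ : Type*) [CommRing Λ] [IsLocalRing Λ]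
variable (A : Type*) [CommRing A] [IsLocalRing A] [Algebra Λ A] [SameResidueField Λ A]

theorem ker_residue : RingHom.ker (algebraMap Λ (ResidueField A)) = maximalIdeal Λ :=
  eq_maximalIdeal (RingHom.ker_isMaximal_of_surjective _ SameResidueField.surj)

theorem isLocalHom_algebraMap : IsLocalHom (algebraMap Λ A) := by
  refine ⟨fun x hx => ?_⟩
  by_contra h
  have h1 : x ∈ RingHom.ker (algebraMap Λ (ResidueField A)) := by
    rw [ker_residue]
    exact (mem_maximalIdeal x).2 h
  rw [RingHom.mem_ker, IsScalarTower.algebraMap_apply Λ A (ResidueField A)] at h1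
  exact (residue_ne_zero_iff_isUnit (algebraMap Λ A x)).2 hx h1

/-- The canonical isomorphism of residue fields `𝕜 = Λ ⧸ 𝔪_Λ ≃ A ⧸ 𝔪_A`. -/
noncomputable def residueEquiv : ResidueField Λ ≃ₐ[Λ] ResidueField A :=
  (Ideal.quotientEquivAlgOfEq Λ (ker_residue Λ A).symm).trans
    (Ideal.quotientKerAlgEquivOfSurjective (f := Algebra.ofId Λ (ResidueField A))
      SameResidueField.surj)

/-- The canonical map `A → 𝕜 = Λ ⧸ 𝔪_Λ` (reduction modulo `𝔪_A`). -/
noncomputable def toResidue : A →ₐ[Λ] ResidueField Λ :=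
  (residueEquiv Λ A).symm.toAlgHom.comp (IsScalarTower.toAlgHom Λ A (ResidueField A))

theorem sameResidueField_of_surjective {B : Type*} [CommRing B] [IsLocalRing B] [Algebra Λ B]
    (f : A →ₐ[Λ] B) (hf : Function.Surjective f) : SameResidueField Λ B := by
  refine ⟨fun y => ?_⟩
  obtain ⟨b, rfl⟩ := residue_surjective y
  obtain ⟨a, rfl⟩ := hf b
  obtain ⟨l, hl⟩ := SameResidueField.surj (Λ := Λ) (A := A) (residue A a)
  refine ⟨l, ?_⟩
  have h1 : residue A (algebraMap Λ A l - a) = 0 := by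
    rw [map_sub, sub_eq_zero]
    exact hl
  have h2 : ¬ IsUnit (algebraMap Λ A l - a) := fun h =>
    (residue_ne_zero_iff_isUnit _).2 h h1
  have : IsLocalHom (f : A →+* B) := .of_surjective _ hf
  have h3 : residue B (f (algebraMap Λ A l - a)) = 0 := by
    by_contra h
    exact h2 (isUnit_of_map_unit (f : A →+* B) _ ((residue_ne_zero_iff_isUnit _).1 h))
  rw [map_sub, map_sub, sub_eq_zero, AlgHom.commutes] at h3
  exact h3

end basic

section dual

instance dualNumber_isLocalRing (A : Type*) [CommRing A] [IsLocalRing A] :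
    IsLocalRing (DualNumber A) := by
  refine .of_nonunits_add fun a b ha hb => ?_
  simp only [mem_nonunits_iff, TrivSqZeroExt.isUnit_iff_isUnit_fst, TrivSqZeroExt.fst_add] at *
  exact nonunits_add ha hb

instance dualNumber_isArtinianRing (A : Type*) [CommRing A] [IsArtinianRing A] :
    IsArtinianRing (DualNumber A) :=
  have : Module.Finite A (DualNumber A) := inferInstanceAs (Module.Finite A (A × A))
  .of_finite A (DualNumber A)

instance dualNumber_sameResidueField (Λ A : Type*) [CommRing Λ] [IsLocalRing Λ] [CommRing A]
    [IsLocalRing A] [Algebra Λ A] [SameResidueField Λ A] :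
    SameResidueField Λ (DualNumber A) := by
  refine ⟨fun y => ?_⟩
  obtain ⟨b, rfl⟩ := residue_surjective y
  obtain ⟨l, hl⟩ := SameResidueField.surj (Λ := Λ) (A := A) (residue A b.fst)
  refine ⟨l, ?_⟩
  have h1 : residue A (algebraMap Λ A l - b.fst) = 0 := by
    rw [map_sub, sub_eq_zero]
    exact hl
  have h2 : ¬ IsUnit (algebraMap Λ (DualNumber A) l - b) := by
    rw [TrivSqZeroExt.isUnit_iff_isUnit_fst]
    exact fun h => (residue_ne_zero_iff_isUnit _).2 h h1
  have h3 : residue (DualNumber A) (algebraMap Λ (DualNumber A) l - b) = 0 := by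
    by_contra h
    exact h2 ((residue_ne_zero_iff_isUnit _).1 h)
  rw [map_sub, sub_eq_zero] at h3
  exact h3

/-- The map `A[ε] → B[ε]`, `a + bε ↦ f(a) + f(b)ε`, induced by `f : A → B`. -/
def dualMap {Λ A B : Type*} [CommRing Λ] [CommRing A] [CommRing B] [Algebra Λ A] [Algebra Λ B]
    (f : A →ₐ[Λ] B) : DualNumber A →ₐ[Λ] DualNumber B where
  toFun x := TrivSqZeroExt.inl (f x.fst) + TrivSqZeroExt.inr (f x.snd)
  map_one' := by apply TrivSqZeroExt.ext <;> simp
  map_mul' x y := by apply TrivSqZeroExt.ext <;> simp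
  map_zero' := by apply TrivSqZeroExt.ext <;> simp
  map_add' x y := by apply TrivSqZeroExt.ext <;> simp
  commutes' r := by apply TrivSqZeroExt.ext <;> simp [TrivSqZeroExt.algebraMap_eq_inl']

end dual

/-- The objects of `C_Λ`: Artin local `Λ`-algebras with residue field `𝕜 = Λ ⧸ 𝔪_Λ`. -/
structure ArtAlg (Λ : Type u) [CommRing Λ] [IsLocalRing Λ] where
  carrier : Type u
  [commRing : CommRing carrier]
  [algebra : Algebra Λ carrier]
  [isLocalRing : IsLocalRing carrier]
  [isArtinianRing : IsArtinianRing carrier]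
  [sameResidueField : SameResidueField Λ carrier]

namespace ArtAlg

attribute [instance] commRing algebra isLocalRing isArtinianRing sameResidueField

variable (Λ : Type u) [CommRing Λ] [IsLocalRing Λ]

/-- Morphisms of `C_Λ` are homomorphisms of `Λ`-algebras (they are automatically local). -/
instance category : Category (ArtAlg Λ) where
  Hom A B := A.carrier →ₐ[Λ] B.carrier
  id A := AlgHom.id Λ A.carrier
  comp f g := AlgHom.comp g f

variable {Λ}

/-- A homomorphism of `Λ`-algebras, as a morphism of `C_Λ`. -/
def ofHom {A B : ArtAlg Λ} (f : A.carrier →ₐ[Λ] B.carrier) : A ⟶ B := f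

variable (Λ) in
/-- The residue field `𝕜` of `Λ`, as an object of `C_Λ`. -/
def resField : ArtAlg Λ :=
  have : SameResidueField Λ (ResidueField Λ) := ⟨by
    intro y
    obtain ⟨x, rfl⟩ := residue_surjective y
    obtain ⟨l, rfl⟩ := residue_surjective x
    exact ⟨l, rfl⟩⟩
  ⟨ResidueField Λ⟩

/-- The dual numbers `A[ε]`, as an object of `C_Λ`. -/
def dual (A : ArtAlg Λ) : ArtAlg Λ := ⟨DualNumber A.carrier⟩

/-- The map `A[ε] → A`, `ε ↦ 0`. -/
def dualFst (A : ArtAlg Λ) : A.dual ⟶ A :=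
  ofHom (A := A.dual) (TrivSqZeroExt.fstHom Λ A.carrier A.carrier)

/-- The map `A[ε] → 𝕜[ε]` induced by `A → 𝕜`. -/
noncomputable def dualRes (A : ArtAlg Λ) : A.dual ⟶ (resField Λ).dual :=
  ofHom (A := A.dual) (B := (resField Λ).dual) (dualMap (toResidue Λ A.carrier))

end ArtAlg

section complete

variable (Λ : Type u) [CommRing Λ] [IsLocalRing Λ]
variable (R : Type u) [CommRing R] [IsLocalRing R] [IsNoetherianRing R]
  [Algebra Λ R] [SameResidueField Λ R]

/-- The quotient `R ⧸ 𝔪_R ^ (n + 1)`, as an object of `C_Λ`. -/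
def quotObj (n : ℕ) : ArtAlg Λ :=
  have hle : maximalIdeal R ^ (n + 1) ≤ maximalIdeal R := Ideal.pow_le_self (Nat.succ_ne_zero n)
  have : Nontrivial (R ⧸ maximalIdeal R ^ (n + 1)) :=
    Ideal.Quotient.nontrivial_iff.2 fun h =>
      (maximalIdeal.isMaximal R).ne_top (top_le_iff.1 (h ▸ hle))
  have : IsLocalRing (R ⧸ maximalIdeal R ^ (n + 1)) :=
    .of_surjective' (Ideal.Quotient.mk _) Ideal.Quotient.mk_surjective
  have : IsArtinianRing (R ⧸ maximalIdeal R ^ (n + 1)) := by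
    rw [isArtinianRing_iff_isNilpotent_maximalIdeal]
    refine ⟨n + 1, ?_⟩
    have h : maximalIdeal (R ⧸ maximalIdeal R ^ (n + 1)) =
        (maximalIdeal R).map (Ideal.Quotient.mk (maximalIdeal R ^ (n + 1))) :=
      (map_maximalIdeal_of_surjective _ Ideal.Quotient.mk_surjective).symm
    rw [h, ← Ideal.map_pow, Ideal.map_quotient_self]
    rfl
  have : SameResidueField Λ (R ⧸ maximalIdeal R ^ (n + 1)) :=
    sameResidueField_of_surjective Λ R (Ideal.Quotient.mkₐ Λ _)
      (Ideal.Quotient.mkₐ_surjective Λ _)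
  ⟨R ⧸ maximalIdeal R ^ (n + 1)⟩

/-- The projection `R ⧸ 𝔪_R ^ (n + 2) → R ⧸ 𝔪_R ^ (n + 1)`. -/
def quotTrans (n : ℕ) : quotObj Λ R (n + 1) ⟶ quotObj Λ R n :=
  ArtAlg.ofHom (A := quotObj Λ R (n + 1)) (B := quotObj Λ R n)
    (Ideal.Quotient.factorₐ Λ (Ideal.pow_le_pow_right (Nat.le_succ (n + 1))))

end complete

section functors

variable {Λ : Type u} [CommRing Λ] [IsLocalRing Λ] (F : ArtAlg Λ ⥤ Type w)

/-- The tangent lifting property: for every `A` in `C_Λ`, the map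
`F(A[ε]) → F(A) × F(𝕜[ε])` is surjective. -/
def TangentLiftingProperty : Prop :=
  ∀ A : ArtAlg Λ, Function.Surjective
    (fun x : F.obj A.dual => (F.map A.dualFst x, F.map A.dualRes x))

/-- The value of `F` on a complete noetherian local `Λ`-algebra `R` with residue field `𝕜`, written
as the limit of its Artin quotients `R ⧸ 𝔪_R ^ (n + 1)`: compatible systems of elements of the
sets `F(R ⧸ 𝔪_R ^ (n + 1))`. -/
def CompletedValue (R : Type u) [CommRing R] [IsLocalRing R] [IsNoetherianRing R]
    [Algebra Λ R] [SameResidueField Λ R] : Type w :=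
  {ξ : ∀ n : ℕ, F.obj (quotObj Λ R n) // ∀ n, F.map (quotTrans Λ R n) (ξ (n + 1)) = ξ n}

/-- A natural transformation `h_R → F`, where `h_R(A) = Hom_Λ(R, A)` for `A` in `C_Λ`, that is
smooth and bijective on tangent spaces: the datum making `R` a hull of `F` in the sense of
Schlessinger. (A homomorphism of `Λ`-algebras from a complete noetherian local `Λ`-algebra `R` with
residue field `𝕜` to an object of `C_Λ` is automatically local and continuous, so that such natural
transformations are the same as elements of the completed value of `F` at `R`.) -/
structure HullDatum (R : Type u) [CommRing R] [Algebra Λ R] where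
  /-- the maps `h_R(A) → F(A)` -/
  app : ∀ A : ArtAlg Λ, (R →ₐ[Λ] A.carrier) → F.obj A
  naturality : ∀ {A B : ArtAlg Λ} (f : A.carrier →ₐ[Λ] B.carrier) (v : R →ₐ[Λ] A.carrier),
    app B (f.comp v) = F.map (ArtAlg.ofHom f) (app A v)
  /-- smoothness: for every surjection `B → A`, the map `h_R(B) → h_R(A) ×_{F(A)} F(B)` is
  surjective -/
  smooth : ∀ {B A : ArtAlg Λ} (f : B.carrier →ₐ[Λ] A.carrier), Function.Surjective f →
    ∀ (v : R →ₐ[Λ] A.carrier) (y : F.obj B), app A v = F.map (ArtAlg.ofHom f) y →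
      ∃ v' : R →ₐ[Λ] B.carrier, f.comp v' = v ∧ app B v' = y
  /-- `h_R(𝕜[ε]) → F(𝕜[ε])` is bijective -/
  tangent : Function.Bijective (app (ArtAlg.resField Λ).dual)

/-- `R` is a hull of `F`. -/
def IsHull (R : Type u) [CommRing R] [Algebra Λ R] : Prop := Nonempty (HullDatum F R)

end functors

/-- Formal smoothness of a local `S`-algebra `R` for the `𝔪_R`-adic topology: every homomorphism of
`S`-algebras `v : R → C ⧸ J`, with `J` a nilpotent ideal of a discrete `S`-algebra `C`, which is
continuous (i.e. kills a power of `𝔪_R`), lifts to a continuous homomorphism `R → C`. -/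
def AdicFormallySmooth (S : Type u) (R : Type u) [CommRing S] [CommRing R] [IsLocalRing R]
    [Algebra S R] : Prop :=
  ∀ (C : Type u) [CommRing C] [Algebra S C] (J : Ideal C), IsNilpotent J →
    ∀ v : R →ₐ[S] C ⧸ J, (∃ n : ℕ, ∀ x ∈ maximalIdeal R ^ n, v x = 0) →
      ∃ v' : R →ₐ[S] C, (∃ n : ℕ, ∀ x ∈ maximalIdeal R ^ n, v' x = 0) ∧
        (Ideal.Quotient.mkₐ S J).comp v' = v

/-- `Spec R` is generically reduced (for noetherian `R`): the local rings at the generic points of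
`Spec R` are reduced. -/
def GenericallyReduced (R : Type*) [CommRing R] : Prop :=
  ∀ (P : Ideal R) [P.IsPrime], P ∈ minimalPrimes R → IsReduced (Localization.AtPrime P)

end TangentLifting

/-!
Let `x_1, …, x_n` in `𝔪_R` lift a basis of the relative cotangent space
`𝔪_R ⧸ (𝔪_Λ R + 𝔪_R ^ 2)`, and write `R = Λ⟦X_1, …, X_n⟧ ⧸ I` accordingly. The idea of the proof is
that the tangent lifting property makes the ideal `I` *stable under the partial derivatives*
(`exists_presentation`). Indeed, by the property and by smoothness of `h_R → F`, every tangent vector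
`R → 𝕜[ε]` lifts to a homomorphism `R → (R ⧸ 𝔪_R ^ N)[ε]` over the projection `R → R ⧸ 𝔪_R ^ N`,
that is, to a `Λ`-derivation `R → R ⧸ 𝔪_R ^ N`. Lifting the basis dual to the `x_j` gives
derivations whose matrix of values on the `x_j` is invertible, so that the partial derivatives of an
element of `I` vanish in `R ⧸ 𝔪_R ^ N` by the chain rule; this holds for all `N`.

*Mixed and zero characteristic.* If a derivative-stable ideal `I` is killed by a homomorphism
`ψ : Λ⟦X⟧ → T` to a torsion-free separated ring, with `ψ(X_i)` topologically nilpotent, then `Λ → T`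
kills all coefficients of the elements of `I` (`DerivStable.algebraMap_coeff_eq_zero`). This is
Taylor's formula at the point `ψ(X)`: all derivatives of `f ∈ I` vanish there, so `f` vanishes. It
suffices to treat the constant coefficient, and then only the operators `C(E, k)` are needed, where
`E = ∑ X_i ∂_i` is the Euler operator: `k! C(E, k)` preserves `I`, and
`f(0) = ∑_k (-1)^k C(E, k) f`. If `Λ` contains `ℚ`, take `T = R`: then `R` is a power series ring
over the image of `Λ`. If there is a point of `F` over `Λ₁`, it gives a homomorphism `R → Λ₁`
(`HullDatum.nonempty_algHom`), and `T` is the quotient of `Λ₁` by its torsion: then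
`R = Λ⟦X_1, …, X_n⟧`. In both cases formal smoothness follows from
`adicFormallySmooth_of_presentation`.

*Characteristic `p`.* Decompose `f = ∑_α X^α g_α(X_1^p, …, X_n^p)` with `0 ≤ α_i < p`. The operators
`∂_i^(p-1)`, together with multiplication by monomials, extract the components
`g_α(X_1^p, …, X_n^p)`, so that these lie in `I` if `f` does (`DerivStable.expand_residuePart_mem`).
Hence `I` is generated by power series in the `X_i^p`. Over a perfect field these are `p`-th powers,
so that a radical derivative-stable proper ideal vanishes, by descent on the order
(`DerivStable.eq_bot_of_isRadical`). If `R` is generically reduced, this applies to the ideal of all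
`f` whose image in `R` vanishes at the generic points of `Spec R`. It contains `I`, so `I = 0`.
-/

namespace TangentLifting

open IsLocalRing

/-! ### Homomorphisms out of power series rings -/

section powerSeries

open MvPowerSeries Finsupp

variable {n : ℕ} {Λ : Type*} [CommRing Λ]

theorem exists_sum_X_mul (f : MvPowerSeries (Fin n) Λ) (N : ℕ)
    (hf : ∀ d, degree d < N + 1 → coeff d f = 0) :
    ∃ g : Fin n → MvPowerSeries (Fin n) Λ, (∀ i d, degree d < N → coeff d (g i) = 0) ∧
      f = ∑ i, X i * g i := by
  classical
  -- each monomial of `f` is assigned to one of the variables dividing it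
  have hex : ∀ d : Fin n →₀ ℕ, d ≠ 0 → ∃ i, d i ≠ 0 := fun d hd => by
    by_contra! h
    exact hd (Finsupp.ext h)
  obtain hn | hn := isEmpty_or_nonempty (Fin n)
  · refine ⟨0, fun i => hn.elim i, ext fun d => ?_⟩
    rw [Subsingleton.elim d 0, hf 0 (by simp)]
    simp
  choose! c hc using hex
  obtain ⟨g, hg⟩ : ∃ g : Fin n → MvPowerSeries (Fin n) Λ, ∀ i d, coeff d (g i) =
      if c (d + single i 1) = i then coeff (d + single i 1) f else 0 :=
    ⟨fun i d => if c (d + single i 1) = i then coeff (d + single i 1) f else 0, fun _ _ => rfl⟩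
  refine ⟨g, fun i d hd => ?_, ext fun d => ?_⟩
  · rw [hg, hf (d + single i 1) (by simpa using hd), ite_self]
  · have key : ∀ i, coeff d (X i * g i) =
        if d i ≠ 0 then (if c d = i then coeff d f else 0) else 0 := by
      intro i
      rw [X_def, coeff_monomial_mul]
      have : single i 1 ≤ d ↔ d i ≠ 0 := by
        rw [single_le_iff, Nat.one_le_iff_ne_zero]
      by_cases h : d i ≠ 0
      · rw [if_pos (this.2 h), if_pos h, one_mul, hg, tsub_add_cancel_of_le (this.2 h)]
      · rw [if_neg (fun h' => h (this.1 h')), if_neg h]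
    rw [map_sum]
    simp only [key]
    by_cases hd : d = 0
    · subst hd
      simpa using hf 0 (by simp)
    · rw [Finset.sum_eq_single (c d)]
      · simp [hc d hd]
      · intro i _ hi
        simp [hi.symm]
      · simp

theorem mem_span_X_pow {N : ℕ} {f : MvPowerSeries (Fin n) Λ}
    (hf : ∀ d, degree d < N → coeff d f = 0) :
    f ∈ Ideal.span (Set.range (X : Fin n → MvPowerSeries (Fin n) Λ)) ^ N := by
  induction N generalizing f with
  | zero => simp
  | succ N ih =>
    obtain ⟨g, hg, rfl⟩ := exists_sum_X_mul f N hf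
    rw [pow_succ']
    exact Ideal.sum_mem _ fun i _ =>
      Ideal.mul_mem_mul (Ideal.subset_span ⟨i, rfl⟩) (ih (hg i))

theorem sub_truncTotal_mem (f : MvPowerSeries (Fin n) Λ) (N : ℕ) :
    f - (f.truncTotal N : MvPolynomial (Fin n) Λ) ∈
      Ideal.span (Set.range (X : Fin n → MvPowerSeries (Fin n) Λ)) ^ N := by
  refine mem_span_X_pow fun d hd => ?_
  rw [map_sub, MvPolynomial.coeff_coe, coeff_truncTotal _ hd, sub_self]

theorem map_span_X_pow_le {A : Type*} [CommRing A] (φ : MvPowerSeries (Fin n) Λ →+* A)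
    {I : Ideal A} (h : ∀ i, φ (X i) ∈ I) (N : ℕ) :
    Ideal.map φ (Ideal.span (Set.range (X : Fin n → MvPowerSeries (Fin n) Λ)) ^ N) ≤ I ^ N := by
  rw [Ideal.map_pow, Ideal.map_span]
  refine Ideal.pow_right_mono (Ideal.span_le.2 ?_) N
  rintro _ ⟨_, ⟨i, rfl⟩, rfl⟩
  exact h i

theorem exists_pow_eq_bot_of_isNilpotent {A : Type*} [CommRing A] {c : Fin n → A}
    (h : ∀ i, IsNilpotent (c i)) : ∃ N, Ideal.span (Set.range c) ^ N = ⊥ := by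
  obtain ⟨N, hN⟩ := Ideal.exists_pow_le_of_le_radical_of_fg
    (I := Ideal.span (Set.range c)) (J := ⊥)
    (Ideal.span_le.2 (by
      rintro _ ⟨i, rfl⟩
      obtain ⟨k, hk⟩ := h i
      exact ⟨k, hk⟩))
    (Submodule.fg_span (Set.finite_range c))
  exact ⟨N, le_bot_iff.1 hN⟩

/-- Homomorphisms from a power series ring are determined by the images of the variables, provided
that these are nilpotent: some power of `(X_1, …, X_n)` is then killed, and polynomials are dense.
No continuity has to be assumed. -/
theorem algHom_ext_of_isNilpotent {A : Type*} [CommRing A] [Algebra Λ A]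
    {φ ψ : MvPowerSeries (Fin n) Λ →ₐ[Λ] A} (h : ∀ i, φ (X i) = ψ (X i))
    (hn : ∀ i, IsNilpotent (φ (X i))) : φ = ψ := by
  obtain ⟨N, hN⟩ := exists_pow_eq_bot_of_isNilpotent hn
  have key : ∀ χ : MvPowerSeries (Fin n) Λ →ₐ[Λ] A, (∀ i, φ (X i) = χ (X i)) →
      ∀ f, χ f = χ (f.truncTotal N : MvPolynomial (Fin n) Λ) := by
    intro χ hχ f
    rw [← sub_eq_zero, ← map_sub]
    have := map_span_X_pow_le (χ : MvPowerSeries (Fin n) Λ →+* A)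
      (I := Ideal.span (Set.range fun i => φ (X i)))
      (fun i => Ideal.subset_span ⟨i, hχ i⟩) N (Ideal.mem_map_of_mem _ (sub_truncTotal_mem f N))
    rw [hN] at this
    exact this
  have hpoly : φ.comp (MvPolynomial.coeToMvPowerSeries.algHom Λ) =
      ψ.comp (MvPolynomial.coeToMvPowerSeries.algHom Λ) := by
    ext i
    simpa using h i
  ext f
  rw [key φ (fun _ => rfl), key ψ h]
  simpa using DFunLike.congr_fun hpoly (f.truncTotal N)

/-- Evaluation of power series at elements that are nilpotent modulo an ideal `I` of an
`I`-adically complete algebra. With `I = 0` this is evaluation at nilpotent elements. -/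
theorem exists_algHom_of_mem_radical {A : Type*} [CommRing A] [Algebra Λ A] (I : Ideal A)
    [IsAdicComplete I A] (c : Fin n → A) (hc : ∀ i, c i ∈ I.radical) :
    ∃ φ : MvPowerSeries (Fin n) Λ →ₐ[Λ] A, ∀ i, φ (X i) = c i := by
  let : WithIdeal A := ⟨I⟩
  let : UniformSpace Λ := ⊥
  have : DiscreteTopology Λ := ⟨rfl⟩
  have hI : IsAdic I := rfl
  obtain ⟨h1, h2⟩ := (IsAdic.isAdicComplete_iff hI).1 inferInstance
  have : ContinuousSMul Λ A := by
    refine ⟨?_⟩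
    rw [continuous_prod_of_discrete_left]
    intro l
    simp only [Algebra.smul_def]
    fun_prop
  have : IsUniformAddGroup Λ := by infer_instance
  have he : HasEval c := by
    refine ⟨fun i => ?_, by simp [Filter.cofinite_eq_bot]⟩
    obtain ⟨k, hk⟩ := hc i
    rw [IsTopologicallyNilpotent, hI.hasBasis_nhds_zero.tendsto_right_iff]
    intro N _
    filter_upwards [Filter.eventually_ge_atTop (k * N)] with m hm
    have : c i ^ (k * N) ∈ I ^ N := by
      rw [pow_mul]
      exact Ideal.pow_mem_pow hk N
    exact Ideal.mem_of_dvd _ (pow_dvd_pow _ hm) this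
  refine ⟨aeval he, fun i => ?_⟩
  have := aeval_coe (R := Λ) he (MvPolynomial.X i)
  simpa using this

end powerSeries

/-! ### Ideals of power series stable under the partial derivatives -/

section stable

open MvPowerSeries Finsupp

variable {n : ℕ} {Λ : Type*} [CommRing Λ]

/-- An ideal of a power series ring which is stable under all partial derivatives. -/
def DerivStable (I : Ideal (MvPowerSeries (Fin n) Λ)) : Prop :=
  ∀ i, ∀ f ∈ I, pderiv Λ i f ∈ I

theorem DerivStable.iterate_mem {I : Ideal (MvPowerSeries (Fin n) Λ)} (hI : DerivStable I)
    (i : Fin n) (m : ℕ) {f : MvPowerSeries (Fin n) Λ} (hf : f ∈ I) :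
    (pderiv Λ i)^[m] f ∈ I := by
  induction m generalizing f with
  | zero => exact hf
  | succ m ih => exact ih (hI i f hf)

/-- The Euler operator `∑ X_i ∂_i` multiplies the homogeneous part of degree `m` by `m`. -/
theorem coeff_sum_X_mul_pderiv (f : MvPowerSeries (Fin n) Λ) (d : Fin n →₀ ℕ) :
    coeff d (∑ i, X i * pderiv Λ i f) = ((degree d : ℕ) : Λ) * coeff d f := by
  classical
  rw [map_sum, degree_eq_sum, Nat.cast_sum, Finset.sum_mul]
  refine Finset.sum_congr rfl fun i _ => ?_
  rw [X_def, coeff_monomial_mul]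
  by_cases h : single i 1 ≤ d
  · rw [if_pos h, coeff_pderiv, tsub_add_cancel_of_le h, one_mul, mul_comm]
    rw [single_le_iff] at h
    congr 1
    rw [tsub_apply, single_eq_same]
    norm_cast
    rw [Nat.sub_add_cancel h]
  · rw [if_neg h]
    rw [single_le_iff, Nat.one_le_iff_ne_zero, not_not] at h
    simp [h]

/-- `∑_d C(|d|, k) a_d X^d` for `f = ∑_d a_d X^d`: the differential operator
`E (E - 1) ⋯ (E - k + 1) / k!` applied to `f`, where `E` is the Euler operator. -/
noncomputable def eulerChoose (k : ℕ) (f : MvPowerSeries (Fin n) Λ) : MvPowerSeries (Fin n) Λ :=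
  fun d => ((degree d).choose k : Λ) * coeff d f

theorem coeff_eulerChoose (k : ℕ) (f : MvPowerSeries (Fin n) Λ) (d : Fin n →₀ ℕ) :
    coeff d (eulerChoose k f) = ((degree d).choose k : Λ) * coeff d f := rfl

theorem DerivStable.factorial_smul_eulerChoose_mem {I : Ideal (MvPowerSeries (Fin n) Λ)}
    (hI : DerivStable I) {f : MvPowerSeries (Fin n) Λ} (hf : f ∈ I) (k : ℕ) :
    k.factorial • eulerChoose k f ∈ I := by
  induction k with
  | zero =>
    have : Nat.factorial 0 • eulerChoose 0 f = f := by
      ext d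
      simp [coeff_eulerChoose]
    rwa [this]
  | succ k ih =>
    set g := k.factorial • eulerChoose k f with hg
    have : (k + 1).factorial • eulerChoose (k + 1) f = (∑ i, X i * pderiv Λ i g) - k • g := by
      ext d
      have h1 : ∀ m : ℕ, (k + 1).factorial * m.choose (k + 1) + k * (k.factorial * m.choose k) =
          m * (k.factorial * m.choose k) := by
        intro m
        rw [← Nat.descFactorial_eq_factorial_mul_choose,
          ← Nat.descFactorial_eq_factorial_mul_choose, Nat.descFactorial_succ]
        obtain h | h := le_or_gt k m
        · rw [← add_mul, Nat.sub_add_cancel h]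
        · simp [Nat.descFactorial_eq_zero_iff_lt.2 h]
      have h2 := congrArg (Nat.cast : ℕ → Λ) (h1 (degree d))
      push_cast at h2
      rw [map_sub, coeff_sum_X_mul_pderiv, hg]
      simp only [map_nsmul, coeff_eulerChoose]
      simp only [nsmul_eq_mul]
      linear_combination coeff d f * h2
    rw [this]
    exact I.sub_mem (I.sum_mem fun i _ => I.mul_mem_left _ (hI i g ih)) (nsmul_mem ih k)

/-- If a derivative-stable ideal vanishes under a homomorphism to a torsion-free ring sending the
variables to topologically nilpotent elements, then the constant coefficients of its elements
vanish there: `∑_k (-1)^k C(m, k) = 0` for `m > 0` gives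
`f(0) = ∑_k (-1)^k (eulerChoose k f)(c)` for a topologically nilpotent point `c`. -/
theorem DerivStable.algebraMap_constantCoeff_eq_zero {I : Ideal (MvPowerSeries (Fin n) Λ)}
    (hI : DerivStable I) {T : Type*} [CommRing T] [Algebra Λ T] [IsAddTorsionFree T]
    (J : Ideal T) [IsHausdorff J T] (ψ : MvPowerSeries (Fin n) Λ →ₐ[Λ] T)
    (hψ : ∀ i, ψ (X i) ∈ J) (hIψ : ∀ f ∈ I, ψ f = 0) {f : MvPowerSeries (Fin n) Λ}
    (hf : f ∈ I) : algebraMap Λ T (constantCoeff f) = 0 := by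
  have h1 : ∀ k, ψ (eulerChoose k f) = 0 := fun k => by
    have := hIψ _ (hI.factorial_smul_eulerChoose_mem hf k)
    rw [map_nsmul] at this
    exact (smul_eq_zero_iff_right k.factorial_ne_zero).1 this
  refine IsHausdorff.haus (I := J) ‹_› _ fun N => ?_
  rw [SModEq.zero, smul_eq_mul, Ideal.mul_top]
  have h2 : (∑ k ∈ Finset.range (N + 1), ((-1 : ℤ) ^ k) • eulerChoose k f) -
      C (constantCoeff f) ∈ Ideal.span (Set.range (X : Fin n → MvPowerSeries (Fin n) Λ)) ^ N := by
    classical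
    refine mem_span_X_pow fun d hd => ?_
    have h3 : ∑ k ∈ Finset.range (N + 1), (-1 : ℤ) ^ k * ((degree d).choose k : ℤ) =
        if degree d = 0 then 1 else 0 := by
      rw [← Int.alternating_sum_range_choose]
      refine (Finset.sum_subset (Finset.range_subset_range.2 (by omega)) fun k _ hk => ?_).symm
      rw [Nat.choose_eq_zero_of_lt (by simpa using hk)]
      simp
    rw [map_sub, map_sum, coeff_C]
    have h4 : ∑ k ∈ Finset.range (N + 1), coeff d (((-1 : ℤ) ^ k) • eulerChoose k f) =
        ((∑ k ∈ Finset.range (N + 1), (-1 : ℤ) ^ k * ((degree d).choose k : ℤ) : ℤ) : Λ) *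
          coeff d f := by
      push_cast
      rw [Finset.sum_mul]
      refine Finset.sum_congr rfl fun k _ => ?_
      rw [map_zsmul, coeff_eulerChoose, zsmul_eq_mul]
      push_cast
      ring
    rw [h4, h3]
    by_cases hd0 : d = 0
    · subst hd0
      simp
    · have : degree d ≠ 0 := fun h => hd0 ((degree_eq_zero_iff d).1 h)
      simp [hd0, this]
  have h5 := map_span_X_pow_le (ψ : MvPowerSeries (Fin n) Λ →+* T) hψ N
    (Ideal.mem_map_of_mem _ h2)
  have h6 : ψ (C (constantCoeff f)) = algebraMap Λ T (constantCoeff f) :=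
    ψ.commutes (constantCoeff f)
  rw [AlgHom.coe_toRingHom, map_sub, map_sum, h6] at h5
  simpa [h1] using h5

theorem DerivStable.algebraMap_coeff_eq_zero {I : Ideal (MvPowerSeries (Fin n) Λ)}
    (hI : DerivStable I) {T : Type*} [CommRing T] [Algebra Λ T] [IsAddTorsionFree T]
    (J : Ideal T) [IsHausdorff J T] (ψ : MvPowerSeries (Fin n) Λ →ₐ[Λ] T)
    (hψ : ∀ i, ψ (X i) ∈ J) (hIψ : ∀ f ∈ I, ψ f = 0) {f : MvPowerSeries (Fin n) Λ}
    (hf : f ∈ I) (d : Fin n →₀ ℕ) : algebraMap Λ T (coeff d f) = 0 := by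
  induction hN : degree d generalizing f d with
  | zero =>
    rw [degree_eq_zero_iff] at hN
    subst hN
    exact hI.algebraMap_constantCoeff_eq_zero J ψ hψ hIψ hf
  | succ N ih =>
    obtain ⟨i, hi⟩ : ∃ i, d i ≠ 0 := by
      by_contra! h
      have : d = 0 := Finsupp.ext h
      simp [this] at hN
    obtain ⟨e, rfl⟩ : ∃ e, d = e + single i 1 :=
      ⟨d - single i 1, (tsub_add_cancel_of_le
        (single_le_iff.2 (Nat.one_le_iff_ne_zero.2 hi))).symm⟩
    have h1 := ih (hI i f hf) e (by simpa using hN)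
    have h2 : (e i + 1) • algebraMap Λ T (coeff (e + single i 1) f) = 0 := by
      rw [← h1, coeff_pderiv, nsmul_eq_mul, map_mul, mul_comm]
      simp
    exact (smul_eq_zero_iff_right (Nat.succ_ne_zero _)).1 h2

end stable

/-! ### Derivative-stable ideals in characteristic `p` -/

section charP

open MvPowerSeries Finsupp

variable {n : ℕ} {Λ : Type*} [CommRing Λ] (p : ℕ)

/-- The power series `g_α` in the decomposition `f = ∑_α X^α g_α(X_1^p, …, X_n^p)`, where the
entries of `α` are less than `p`. -/
noncomputable def residuePart (a : Fin n →₀ ℕ) (f : MvPowerSeries (Fin n) Λ) :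
    MvPowerSeries (Fin n) Λ :=
  fun b => coeff (p • b + a) f

theorem coeff_residuePart (a : Fin n →₀ ℕ) (f : MvPowerSeries (Fin n) Λ) (b : Fin n →₀ ℕ) :
    coeff b (residuePart p a f) = coeff (p • b + a) f := rfl

theorem coeff_expand_residuePart (hp : p ≠ 0) (a : Fin n →₀ ℕ) (f : MvPowerSeries (Fin n) Λ)
    (d : Fin n →₀ ℕ) : coeff d (expand p hp (residuePart p a f)) =
      if ∀ i, p ∣ d i then coeff (d + a) f else 0 := by
  split_ifs with h
  · have : d = p • d.mapRange (· / p) (Nat.zero_div p) := by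
      ext i
      simp [Nat.mul_div_cancel' (h i)]
    rw [this, coeff_expand_smul, coeff_residuePart]
  · push Not at h
    obtain ⟨i, hi⟩ := h
    exact coeff_expand_of_not_dvd p hp _ hi

theorem eq_sum_monomial_mul_expand_residuePart (hp : p ≠ 0) (f : MvPowerSeries (Fin n) Λ) :
    f = ∑ a : Fin n → Fin p, monomial (equivFunOnFinite.symm fun i => (a i : ℕ)) 1 *
      expand p hp (residuePart p (equivFunOnFinite.symm fun i => (a i : ℕ)) f) := by
  classical
  ext d
  rw [map_sum, Finset.sum_eq_single
    (fun i => ⟨d i % p, Nat.mod_lt _ (Nat.pos_of_ne_zero hp)⟩ : Fin n → Fin p)]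
  · set a : Fin n →₀ ℕ := equivFunOnFinite.symm fun i => d i % p with ha
    have hle : a ≤ d := fun i => Nat.mod_le _ _
    change coeff d f = coeff d (monomial a 1 * expand p hp (residuePart p a f))
    rw [coeff_monomial_mul, if_pos hle, one_mul, coeff_expand_residuePart, if_pos,
      tsub_add_cancel_of_le hle]
    intro i
    exact Nat.dvd_sub_mod (d i)
  · intro a _ ha
    rw [coeff_monomial_mul]
    split_ifs with h
    · rw [one_mul, coeff_expand_residuePart, if_neg]
      contrapose! ha
      ext i
      have h1 := ha i
      have h2 : (a i : ℕ) ≤ d i := h i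
      simp only [coe_tsub, Pi.sub_apply, equivFunOnFinite_symm_apply_apply] at h1
      change (a i : ℕ) = d i % p
      rw [← Nat.mod_eq_of_lt (a i).2]
      exact (Nat.modEq_iff_dvd' h2).2 h1
    · rfl
  · simp

theorem coeff_iterate_pderiv (i : Fin n) (m : ℕ) (f : MvPowerSeries (Fin n) Λ)
    (d : Fin n →₀ ℕ) : coeff d ((pderiv Λ i)^[m] f) =
      coeff (d + single i m) f * ((d i + 1).ascFactorial m : Λ) := by
  induction m generalizing f with
  | zero => simp
  | succ m ih =>
    rw [Function.iterate_succ_apply, ih, coeff_pderiv, Nat.ascFactorial_succ, add_assoc,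
      ← single_add]
    simp only [coe_add, Pi.add_apply, single_eq_same]
    push_cast
    ring

variable [Fact p.Prime] [CharP Λ p]

/-- The scalar by which `∂_i^(p-1)` acts on the monomials: it maps `X_i^(m+p-1)` to
`(m + 1) ⋯ (m + p - 1) X_i^m`. -/
theorem natCast_ascFactorial_pred (m : ℕ) : ((m + 1).ascFactorial (p - 1) : Λ) =
    if p ∣ m then ((p - 1).factorial : Λ) else 0 := by
  have hp : p.Prime := Fact.out
  split_ifs with h
  · have h0 : (m : Λ) = 0 := (CharP.cast_eq_zero_iff Λ p m).2 h
    rw [← Nat.one_ascFactorial, Nat.ascFactorial_eq_prod_range, Nat.ascFactorial_eq_prod_range]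
    push_cast
    simp [h0]
  · rw [CharP.cast_eq_zero_iff Λ p]
    have h1 : m.ascFactorial p = m * (m + 1).ascFactorial (p - 1) := by
      obtain ⟨q, rfl⟩ : ∃ q, p = q + 1 := ⟨p - 1, (Nat.sub_add_cancel hp.one_le).symm⟩
      rw [Nat.add_sub_cancel, Nat.ascFactorial_eq_prod_range, Nat.ascFactorial_eq_prod_range,
        Finset.prod_range_succ', mul_comm]
      simp [add_comm, add_left_comm]
    have h2 : p ∣ m * (m + 1).ascFactorial (p - 1) :=
      h1 ▸ (Nat.dvd_factorial hp.pos le_rfl).trans (Nat.factorial_dvd_ascFactorial m p)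
    exact (hp.dvd_mul.1 h2).resolve_left h

/-- A derivative-stable ideal contains the components of its elements with respect to the
decomposition `f = ∑_α X^α g_α(X_1^p, …, X_n^p)`. They are obtained by the operators
`f ↦ ∂_i^(p-1) (X_i^(p-1-α_i) f)`, which are Cartier operators up to a scalar: `∂_i^(p-1)` kills
`X_i^m` unless `m` is `p - 1` modulo `p`. -/
theorem DerivStable.expand_residuePart_mem (hp : p ≠ 0) (hΛ : IsField Λ)
    {I : Ideal (MvPowerSeries (Fin n) Λ)} (hI : DerivStable I)
    {f : MvPowerSeries (Fin n) Λ} (hf : f ∈ I) (a : Fin n →₀ ℕ) (ha : ∀ i, a i < p) :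
    expand p hp (residuePart p a f) ∈ I := by
  classical
  have hp' : p.Prime := Fact.out
  obtain ⟨u, hu⟩ := hΛ.mul_inv_cancel (a := ((p - 1).factorial : Λ)) (by
    rw [Ne, CharP.cast_eq_zero_iff Λ p, hp'.dvd_factorial]
    have := hp'.pos
    omega)
  have key : ∀ s : Finset (Fin n), ∃ F ∈ I, ∀ d, coeff d F =
      if ∀ i ∈ s, p ∣ d i then coeff (d + ∑ i ∈ s, single i (a i)) f else 0 := by
    intro s
    induction s using Finset.induction_on with
    | empty => exact ⟨f, hf, fun d => by simp⟩
    | insert i s his ih =>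
      obtain ⟨F, hF, hFc⟩ := ih
      refine ⟨C u * (pderiv Λ i)^[p - 1] (X i ^ (p - 1 - a i) * F),
        I.mul_mem_left _ (hI.iterate_mem i _ (I.mul_mem_left _ hF)), fun d => ?_⟩
      have hs : single i (p - 1) = single i (p - 1 - a i) + single i (a i) := by
        rw [← single_add, Nat.sub_add_cancel]
        have := ha i
        omega
      have hd : d + single i (p - 1) = single i (p - 1 - a i) + (d + single i (a i)) := by
        rw [hs]
        abel
      rw [coeff_C_mul, coeff_iterate_pderiv, natCast_ascFactorial_pred, hd, X_pow_eq,
        coeff_add_monomial_mul, one_mul, hFc, Finset.sum_insert his, ← add_assoc]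
      have hcongr : (∀ j ∈ s, p ∣ (d + single i (a i)) j) ↔ ∀ j ∈ s, p ∣ d j := by
        refine forall₂_congr fun j hj => ?_
        have : i ≠ j := fun h => his (h ▸ hj)
        simp [single_eq_of_ne' this]
      simp only [hcongr, Finset.forall_mem_insert]
      by_cases h1 : p ∣ d i <;> by_cases h2 : ∀ j ∈ s, p ∣ d j
      · rw [if_pos h1, if_pos h2, if_pos ⟨h1, h2⟩, mul_left_comm, mul_comm u, hu, mul_one]
      · simp [h2]
      · simp [h1]
      · simp [h1]
  obtain ⟨F, hF, hFc⟩ := key Finset.univ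
  convert hF
  ext d
  rw [coeff_expand_residuePart, hFc]
  simp [univ_sum_single]

/-- In characteristic `p`, a derivative-stable ideal is generated by power series in
`X_1^p, …, X_n^p`. -/
theorem DerivStable.exists_eq_span_expand (hp : p ≠ 0) (hΛ : IsField Λ) [IsNoetherianRing Λ]
    {I : Ideal (MvPowerSeries (Fin n) Λ)} (hI : DerivStable I) :
    ∃ (r : ℕ) (g : Fin r → MvPowerSeries (Fin n) Λ),
      I = Ideal.span (Set.range fun i => expand p hp (g i)) := by
  set S : Set (MvPowerSeries (Fin n) Λ) := {f | f ∈ I ∧ ∃ g, expand p hp g = f} with hS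
  have h1 : I = Ideal.span S := by
    refine le_antisymm (fun f hf => ?_) (Ideal.span_le.2 fun f hf => hf.1)
    rw [eq_sum_monomial_mul_expand_residuePart p hp f]
    exact Ideal.sum_mem _ fun a _ => Ideal.mul_mem_left _ _ (Ideal.subset_span
      ⟨hI.expand_residuePart_mem p hp hΛ hf _ fun i => (a i).2, _, rfl⟩)
  obtain ⟨t, htS, ht⟩ := (Submodule.fg_span_iff_fg_span_finset_subset S).1
    (IsNoetherian.noetherian (Ideal.span S))
  have h2 : ∀ x : t, ∃ g, expand p hp g = x.1 := fun x => (htS x.2).2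
  choose g hg using h2
  refine ⟨t.card, fun i => g (t.equivFin.symm i), ?_⟩
  rw [h1]
  refine Eq.trans ht ?_
  congr 1
  ext x
  simp only [hg, Set.mem_range, Finset.mem_coe]
  constructor
  · intro hx
    exact ⟨t.equivFin ⟨x, hx⟩, by simp⟩
  · rintro ⟨i, rfl⟩
    exact (t.equivFin.symm i).2

/-- Over a perfect field of characteristic `p`, a proper radical derivative-stable ideal is zero:
the components `g_α(X_1^p, …, X_n^p)` of an element are `p`-th powers, hence the ideal contains
their `p`-th roots, whose orders are smaller. -/
theorem DerivStable.eq_bot_of_isRadical (hΛ : IsField Λ) [PerfectRing Λ p]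
    {I : Ideal (MvPowerSeries (Fin n) Λ)} (hI : DerivStable I) (hrad : I.IsRadical)
    (htop : I ≠ ⊤) : I = ⊥ := by
  have hp' : p.Prime := Fact.out
  have hp := hp'.ne_zero
  have key : ∀ N d, degree d = N → ∀ f ∈ I, coeff d f = 0 := by
    intro N
    induction N using Nat.strong_induction_on with
    | _ N ih =>
      intro d hd f hf
      obtain rfl | hN := Nat.eq_zero_or_pos N
      · rw [degree_eq_zero_iff] at hd
        subst hd
        by_contra h
        obtain ⟨u, hu⟩ := hΛ.mul_inv_cancel h
        exact htop (I.eq_top_of_isUnit_mem hf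
          (isUnit_iff_constantCoeff.2 (IsUnit.of_mul_eq_one u hu)))
      · set a : Fin n →₀ ℕ := d.mapRange (· % p) (Nat.zero_mod p) with ha
        set b : Fin n →₀ ℕ := d.mapRange (· / p) (Nat.zero_div p) with hb
        have hdab : d = p • b + a := by
          ext i
          simp [ha, hb, Nat.div_add_mod]
        have hmem := hI.expand_residuePart_mem p hp hΛ hf a
          (fun i => by simpa [ha] using Nat.mod_lt _ hp'.pos)
        set h := MvPowerSeries.map ((frobeniusEquiv Λ p).symm : Λ →+* Λ) (residuePart p a f) with hh
        have hpow : h ^ p = expand p hp (residuePart p a f) := by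
          rw [← map_frobenius_expand p hp, MvPowerSeries.map_expand]
          congr 1
          ext e
          simp [hh]
        have hhI : h ∈ I := hrad ⟨p, hpow ▸ hmem⟩
        have hlt : degree b < N := by
          rw [← hd, hdab, map_add, map_nsmul, smul_eq_mul]
          have h2 := hp'.two_le
          by_contra! hle
          have h3 : degree b = 0 := by nlinarith
          have h4 : degree a = 0 := by omega
          rw [hdab, map_add, map_nsmul, h3, h4] at hd
          simp at hd
          omega
        have h0 := ih _ hlt b rfl h hhI
        rw [hh, coeff_map, coeff_residuePart, ← hdab] at h0
        simpa using h0
  rw [eq_bot_iff]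
  intro f hf
  rw [Ideal.mem_bot]
  ext d
  exact key _ d rfl f hf

end charP

/-! ### Formal smoothness from a presentation -/

/-- If `R = Λ⟦X_1, …, X_n⟧ ⧸ I` where all coefficients of the elements of `I` vanish in the quotient
`S` of `Λ`, so that `R = S⟦X_1, …, X_n⟧`, then `R` is formally smooth over `S`: lift the images of
the variables arbitrarily; the lifts are nilpotent. -/
theorem adicFormallySmooth_of_presentation {Λ : Type*} {S R : Type u} [CommRing Λ] [CommRing S]
    [CommRing R] [IsLocalRing R] [Algebra Λ S] [Algebra S R] [Algebra Λ R] [IsScalarTower Λ S R]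
    (hS : Function.Surjective (algebraMap Λ S)) {n : ℕ}
    (φ : MvPowerSeries (Fin n) Λ →ₐ[Λ] R) (hφ : Function.Surjective φ)
    (hX : ∀ i, φ (MvPowerSeries.X i) ∈ maximalIdeal R)
    (hker : ∀ f, φ f = 0 → ∀ d, algebraMap Λ S (MvPowerSeries.coeff d f) = 0) :
    AdicFormallySmooth S R := by
  intro C _ _ J ⟨k, hJ⟩ v ⟨N, hv⟩
  let : Algebra Λ C := Algebra.compHom C (algebraMap Λ S)
  have : IsScalarTower Λ S C := .of_algebraMap_eq fun _ => rfl
  choose c hc using fun i => Ideal.Quotient.mk_surjective (v (φ (MvPowerSeries.X i)))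
  have hnilX : ∀ i, v (φ (MvPowerSeries.X i)) ^ N = 0 := fun i => by
    rw [← map_pow]
    exact hv _ (Ideal.pow_mem_pow (hX i) N)
  have hnil : ∀ i, IsNilpotent (c i) := fun i => by
    refine ⟨N * k, ?_⟩
    have h1 : c i ^ N ∈ J := by
      rw [← Ideal.Quotient.eq_zero_iff_mem, map_pow, hc, hnilX]
    have h2 := Ideal.pow_mem_pow h1 k
    rw [hJ] at h2
    rw [pow_mul]
    exact h2
  obtain ⟨ev, hev⟩ := exists_algHom_of_mem_radical (Λ := Λ) (⊥ : Ideal C) c hnil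
  have hevker : ∀ f, φ f = 0 → ev f = 0 := by
    intro f hf
    obtain ⟨M, hM⟩ := exists_pow_eq_bot_of_isNilpotent hnil
    have h1 := map_span_X_pow_le (ev : MvPowerSeries (Fin n) Λ →+* C)
      (I := Ideal.span (Set.range c)) (fun i => Ideal.subset_span ⟨i, (hev i).symm⟩) M
      (Ideal.mem_map_of_mem _ (sub_truncTotal_mem f M))
    rw [hM, Ideal.mem_bot, AlgHom.coe_toRingHom, map_sub, sub_eq_zero] at h1
    have h2 : ev.comp (MvPolynomial.coeToMvPowerSeries.algHom Λ) = MvPolynomial.aeval c := by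
      ext i
      simpa using hev i
    have h3 := DFunLike.congr_fun h2 (f.truncTotal M)
    have h4 : MvPolynomial.map (algebraMap Λ C) (f.truncTotal M) = 0 := by
      ext d
      rw [MvPolynomial.coeff_map, MvPolynomial.coeff_zero]
      by_cases hd : Finsupp.degree d < M
      · rw [MvPowerSeries.coeff_truncTotal _ hd, IsScalarTower.algebraMap_apply Λ S C,
          hker f hf, map_zero]
      · rw [MvPowerSeries.coeff_truncTotal_eq_zero _ (not_lt.1 hd), map_zero]
    rw [MvPolynomial.aeval_def, MvPolynomial.eval₂_eq_eval_map, h4, map_zero] at h3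
    rw [h1]
    simpa using h3
  let w : R →+* C := RingHom.liftOfSurjective (φ : MvPowerSeries (Fin n) Λ →+* R) hφ
    ⟨ev, fun f hf => hevker f hf⟩
  have hw : ∀ f, w (φ f) = ev f := fun f =>
    RingHom.liftOfRightInverse_comp_apply _ _ _ _ f
  let v' : R →ₐ[S] C :=
    { w with
      commutes' := fun s => by
        obtain ⟨l, rfl⟩ := hS s
        change w _ = _
        rw [← IsScalarTower.algebraMap_apply, ← IsScalarTower.algebraMap_apply, ← φ.commutes,
          hw, ev.commutes] }
  have hcomp : (Ideal.Quotient.mkₐ S J).comp v' = v := by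
    have h1 : (Ideal.Quotient.mkₐ Λ J).comp ev = (v.restrictScalars Λ).comp φ := by
      refine algHom_ext_of_isNilpotent (fun i => ?_) fun i => ?_
      · simp [hev, hc]
      · exact ⟨N, by simp [hev, hc, hnilX]⟩
    ext r
    obtain ⟨f, rfl⟩ := hφ r
    have h2 := DFunLike.congr_fun h1 f
    change Ideal.Quotient.mk J (w (φ f)) = _
    rw [hw]
    exact h2
  refine ⟨v', ⟨N * k, fun x hx => ?_⟩, hcomp⟩
  have h1 : maximalIdeal R ^ N ≤ J.comap v' := fun y hy => by
    rw [Ideal.mem_comap, ← Ideal.Quotient.eq_zero_iff_mem]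
    have := DFunLike.congr_fun hcomp y
    rw [hv y hy] at this
    exact this
  rw [pow_mul] at hx
  have h2 := Ideal.le_comap_pow (v' : R →+* C) k (Ideal.pow_right_mono h1 k hx)
  rw [hJ] at h2
  exact h2

/-! ### The presentation of a hull -/

/-- The tangent lifting property, in terms of a hull `R`: a homomorphism `R → A` and a tangent
vector `R → 𝕜[ε]` come from a common homomorphism `R → A[ε]`. -/
theorem exists_algHom_dual {Λ R : Type u} [CommRing Λ] [IsLocalRing Λ] [CommRing R]
    [Algebra Λ R] {F : CategoryTheory.Functor (ArtAlg Λ) (Type w)} (hF : TangentLiftingProperty F)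
    (H : HullDatum F R) (A : ArtAlg Λ) (v : R →ₐ[Λ] A.carrier)
    (t : R →ₐ[Λ] DualNumber (ResidueField Λ)) :
    ∃ v' : R →ₐ[Λ] DualNumber A.carrier, (∀ r, (v' r).fst = v r) ∧
      ∀ r, toResidue Λ A.carrier (v' r).snd = (t r).snd := by
  obtain ⟨y, hy⟩ := hF A (H.app A v, H.app (ArtAlg.resField Λ).dual t)
  have hy1 : F.map A.dualFst y = H.app A v := congrArg Prod.fst hy
  have hy2 : F.map A.dualRes y = H.app (ArtAlg.resField Λ).dual t := congrArg Prod.snd hy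
  obtain ⟨v', hv', hv''⟩ := H.smooth (B := A.dual) (A := A)
    (TrivSqZeroExt.fstHom Λ A.carrier A.carrier) (fun a => ⟨TrivSqZeroExt.inl a, rfl⟩) v y hy1.symm
  have h2 := H.naturality (A := A.dual) (B := (ArtAlg.resField Λ).dual)
    (dualMap (toResidue Λ A.carrier)) v'
  rw [hv''] at h2
  have h3 := H.tangent.1 (h2.trans hy2)
  refine ⟨v', fun r => DFunLike.congr_fun hv' r, fun r => ?_⟩
  have h4 := congrArg TrivSqZeroExt.snd (DFunLike.congr_fun h3 r)
  refine Eq.trans ?_ h4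
  change _ = (TrivSqZeroExt.inl (toResidue Λ A.carrier (v' r).fst) +
    TrivSqZeroExt.inr (toResidue Λ A.carrier (v' r).snd) : DualNumber (ResidueField Λ)).snd
  simp only [TrivSqZeroExt.snd_add, TrivSqZeroExt.snd_inl, TrivSqZeroExt.snd_inr, zero_add]
  rfl

/-- Every element of `F(A)` comes from the hull. In particular `F(𝕜)` is a single point, although
this is not part of the definition of a hull: `F(𝕜[ε]) → F(𝕜)` is split surjective, and
`h_R(𝕜[ε]) → F(𝕜[ε])` is surjective. -/
theorem HullDatum.exists_app_eq {Λ R : Type u} [CommRing Λ] [IsLocalRing Λ] [CommRing R]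
    [Algebra Λ R] {F : CategoryTheory.Functor (ArtAlg Λ) (Type w)} (H : HullDatum F R)
    (A : ArtAlg Λ) (y : F.obj A) : ∃ v : R →ₐ[Λ] A.carrier, H.app A v = y := by
  let k := ArtAlg.resField Λ
  let π : A.carrier →ₐ[Λ] k.carrier := toResidue Λ A.carrier
  let ι : k ⟶ k.dual := ArtAlg.ofHom (B := k.dual) (TrivSqZeroExt.inlAlgHom Λ k.carrier k.carrier)
  have hπ : Function.Surjective π := fun z => by
    obtain ⟨l, rfl⟩ := residue_surjective z
    exact ⟨algebraMap Λ A.carrier l, π.commutes l⟩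
  have hι : CategoryTheory.CategoryStruct.comp ι k.dualFst = CategoryTheory.CategoryStruct.id k :=
    AlgHom.ext fun z => rfl
  obtain ⟨t, ht⟩ := H.tangent.2 (F.map ι (F.map (ArtAlg.ofHom π) y))
  have h1 := H.naturality (A := k.dual) (B := k) (TrivSqZeroExt.fstHom Λ k.carrier k.carrier) t
  rw [ht] at h1
  have h2 : F.map k.dualFst (F.map ι (F.map (ArtAlg.ofHom π) y)) = F.map (ArtAlg.ofHom π) y := by
    rw [← CategoryTheory.Functor.map_comp_apply, hι,
      CategoryTheory.Functor.map_id_apply]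
  obtain ⟨v, -, hv⟩ := H.smooth π hπ _ y (h1.trans h2)
  exact ⟨v, hv⟩

/-- The chain rule: `f ↦ v(f) + ε ∑_j v(∂_j f) m_j` is a homomorphism to the dual numbers. -/
theorem exists_algHom_dualNumber_pderiv {Λ : Type*} [CommRing Λ] {n : ℕ}
    {A : Type*} [CommRing A] [Algebra Λ A]
    (v : MvPowerSeries (Fin n) Λ →ₐ[Λ] A) (m : Fin n → A) :
    ∃ h : MvPowerSeries (Fin n) Λ →ₐ[Λ] DualNumber A, ∀ f, h f = TrivSqZeroExt.inl (v f) +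
      TrivSqZeroExt.inr (∑ j, v (MvPowerSeries.pderiv Λ j f) * m j) := by
  refine ⟨
    { toFun := fun f => TrivSqZeroExt.inl (v f) +
        TrivSqZeroExt.inr (∑ j, v (MvPowerSeries.pderiv Λ j f) * m j)
      map_one' := ?_
      map_mul' := fun f g => ?_
      map_zero' := ?_
      map_add' := fun f g => ?_
      commutes' := fun l => ?_ }, fun f => rfl⟩
  · apply TrivSqZeroExt.ext <;> simp
  · apply TrivSqZeroExt.ext
    · simp
    · simp only [TrivSqZeroExt.snd_add, TrivSqZeroExt.snd_inl, TrivSqZeroExt.snd_inr, zero_add,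
        TrivSqZeroExt.snd_mul, TrivSqZeroExt.fst_add, TrivSqZeroExt.fst_inl,
        TrivSqZeroExt.fst_inr, add_zero, Derivation.leibniz, map_add, smul_eq_mul, map_mul,
        MulOpposite.smul_eq_mul_unop, MulOpposite.unop_op, Finset.mul_sum, Finset.sum_mul,
        ← Finset.sum_add_distrib]
      exact Finset.sum_congr rfl fun j _ => by ring
  · apply TrivSqZeroExt.ext <;> simp
  · apply TrivSqZeroExt.ext <;> simp [add_mul, Finset.sum_add_distrib]
  · apply TrivSqZeroExt.ext <;> simp [TrivSqZeroExt.algebraMap_eq_inl']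

section presentation

variable {Λ R : Type*} [CommRing Λ] [IsLocalRing Λ] [CommRing R] [IsLocalRing R]
  [Algebra Λ R] [SameResidueField Λ R]

variable (Λ) in
theorem exists_sub_algebraMap_mem (r : R) : ∃ l : Λ, r - algebraMap Λ R l ∈ maximalIdeal R := by
  obtain ⟨l, hl⟩ := SameResidueField.surj (Λ := Λ) (A := R) (residue R r)
  refine ⟨l, (residue_eq_zero_iff _).1 ?_⟩
  rw [map_sub, ← hl, sub_eq_zero]
  rfl

theorem algebraMap_mem_maximalIdeal_iff {l : Λ} :
    algebraMap Λ R l ∈ maximalIdeal R ↔ l ∈ maximalIdeal Λ := by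
  have := isLocalHom_algebraMap Λ R
  rw [mem_maximalIdeal, mem_maximalIdeal, mem_nonunits_iff, mem_nonunits_iff,
    isUnit_map_iff]

theorem toResidue_apply (r : R) : toResidue Λ R r = (residueEquiv Λ R).symm (residue R r) := rfl

theorem toResidue_eq_zero_of_mem {r : R} (hr : r ∈ maximalIdeal R) : toResidue Λ R r = 0 := by
  rw [toResidue_apply, (residue_eq_zero_iff r).2 hr, map_zero]

theorem isUnit_matrix_of_toResidue {n : ℕ} {M : Matrix (Fin n) (Fin n) R}
    (h : ∀ i j, toResidue Λ R (M i j) = if i = j then 1 else 0) : IsUnit M := by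
  rw [Matrix.isUnit_iff_isUnit_det]
  by_contra hM
  have h1 := toResidue_eq_zero_of_mem (Λ := Λ) ((mem_maximalIdeal _).2 hM)
  have h2 : (toResidue Λ R).mapMatrix M = 1 := by
    ext i j
    simp [h, Matrix.one_apply]
  rw [AlgHom.map_det, h2, Matrix.det_one] at h1
  exact one_ne_zero h1

theorem surjective_of_maximalIdeal_le [IsNoetherianRing R] [IsAdicComplete (maximalIdeal Λ) Λ]
    {n : ℕ} (φ : MvPowerSeries (Fin n) Λ →ₐ[Λ] R)
    (hX : ∀ i, φ (MvPowerSeries.X i) ∈ maximalIdeal R)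
    (hm : maximalIdeal R ≤ Ideal.span (Set.range fun i => φ (MvPowerSeries.X i)) ⊔
      (maximalIdeal Λ).map (algebraMap Λ R) ⊔ maximalIdeal R ^ 2) :
    Function.Surjective φ := by
  set J : Ideal (MvPowerSeries (Fin n) Λ) := Ideal.span (Set.range MvPowerSeries.X) with hJ
  set K : Ideal R := J.map (φ : MvPowerSeries (Fin n) Λ →+* R) with hK
  have hKspan : K = Ideal.span (Set.range fun i => φ (MvPowerSeries.X i)) := by
    rw [hK, hJ, Ideal.map_span, ← Set.range_comp]
    rfl
  have hm' : maximalIdeal R ≤ K ⊔ (maximalIdeal Λ).map (algebraMap Λ R) := by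
    refine Submodule.le_of_le_smul_of_le_jacobson_bot (I := maximalIdeal R)
      (IsNoetherian.noetherian _) (IsLocalRing.maximalIdeal_le_jacobson _) ?_
    rw [smul_eq_mul, ← pow_two, hKspan]
    exact hm
  have hKle : K ≤ maximalIdeal R := by
    rw [hKspan, Ideal.span_le]
    rintro _ ⟨i, rfl⟩
    exact hX i
  have hKtop : K ≠ ⊤ := fun h => (maximalIdeal.isMaximal R).ne_top (top_le_iff.1 (h ▸ hKle))
  have : Nontrivial (R ⧸ K) := Ideal.Quotient.nontrivial_iff.2 hKtop
  have : IsLocalRing (R ⧸ K) := .of_surjective' (Ideal.Quotient.mk _) Ideal.Quotient.mk_surjective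
  have hh1 : IsHausdorff K R := IsHausdorff.of_isLocalRing _ _ hKtop
  -- `Λ` surjects onto `R ⧸ (x_1, …, x_n)`, whose maximal ideal is generated by `𝔪_Λ`
  have h1 : Function.Surjective (algebraMap Λ (R ⧸ K)) := by
    have hne : (maximalIdeal Λ).map (algebraMap Λ (R ⧸ K)) ≠ ⊤ := by
      intro h
      have h2 : (maximalIdeal Λ).map (algebraMap Λ (R ⧸ K)) ≤ maximalIdeal (R ⧸ K) := by
        rw [Ideal.map_le_iff_le_comap]
        intro l hl
        have : SameResidueField Λ (R ⧸ K) := sameResidueField_of_surjective Λ R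
          (Ideal.Quotient.mkₐ Λ K) (Ideal.Quotient.mkₐ_surjective Λ K)
        exact algebraMap_mem_maximalIdeal_iff.2 hl
      exact (maximalIdeal.isMaximal (R ⧸ K)).ne_top (top_le_iff.1 (h ▸ h2))
    have hh2 : IsHausdorff ((maximalIdeal Λ).map (algebraMap Λ (R ⧸ K))) (R ⧸ K) :=
      IsHausdorff.of_isLocalRing _ _ hne
    refine surjective_of_mk_map_comp_surjective (I := maximalIdeal Λ) _ fun y => ?_
    obtain ⟨y, rfl⟩ := Ideal.Quotient.mk_surjective y
    obtain ⟨r, rfl⟩ := Ideal.Quotient.mk_surjective y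
    obtain ⟨l, hl⟩ := exists_sub_algebraMap_mem Λ r
    refine ⟨l, Eq.symm ((Ideal.Quotient.mk_eq_mk_iff_sub_mem _ _).2 ?_)⟩
    have h3 := Ideal.mem_map_of_mem (Ideal.Quotient.mk K) (hm' hl)
    rwa [Ideal.map_sup, Ideal.map_quotient_self, bot_sup_eq, Ideal.map_map, map_sub] at h3
  refine surjective_of_mk_map_comp_surjective (I := J)
    (φ : MvPowerSeries (Fin n) Λ →+* R) fun y => ?_
  obtain ⟨l, hl⟩ := h1 y
  refine ⟨algebraMap Λ _ l, ?_⟩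
  rw [← hl, RingHom.comp_apply, AlgHom.coe_toRingHom, φ.commutes]
  rfl

/-- A linear form on `𝔪_R` with values in the residue field which vanishes on the image of `𝔪_Λ`
extends to a tangent vector `R → 𝕜[ε]`. -/
theorem exists_algHom_dualNumber (ℓ : maximalIdeal R →ₗ[R] ResidueField R)
    (hℓ : ∀ (l : Λ) (h : algebraMap Λ R l ∈ maximalIdeal R), ℓ ⟨_, h⟩ = 0) :
    ∃ t : R →ₐ[Λ] DualNumber (ResidueField Λ), ∀ m : maximalIdeal R,
      (t m).snd = (residueEquiv Λ R).symm (ℓ m) := by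
  choose σ hσ using exists_sub_algebraMap_mem Λ (R := R)
  have key : ∀ (r : R) (l : Λ) (h : r - algebraMap Λ R l ∈ maximalIdeal R),
      ℓ ⟨_, hσ r⟩ = ℓ ⟨_, h⟩ := by
    intro r l h
    have h1 : algebraMap Λ R (l - σ r) ∈ maximalIdeal R := by
      have := sub_mem (hσ r) h
      rwa [sub_sub_sub_cancel_left, ← map_sub] at this
    rw [← sub_eq_zero, ← map_sub, ← hℓ _ h1]
    congr 1
    ext
    simp
  obtain ⟨δ, hδ⟩ : ∃ δ : R → ResidueField R, ∀ (r : R) (l : Λ)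
      (h : r - algebraMap Λ R l ∈ maximalIdeal R), δ r = ℓ ⟨_, h⟩ := ⟨_, key⟩
  have hadd : ∀ r s, δ (r + s) = δ r + δ s := fun r s => by
    have h : r + s - algebraMap Λ R (σ r + σ s) = (r - algebraMap Λ R (σ r)) +
        (s - algebraMap Λ R (σ s)) := by
      rw [map_add]
      ring
    rw [hδ (r + s) (σ r + σ s) (h ▸ add_mem (hσ r) (hσ s)), hδ r _ (hσ r), hδ s _ (hσ s),
      ← map_add]
    exact congrArg ℓ (Subtype.ext h)
  have hmul : ∀ r s, δ (r * s) = residue R r * δ s + residue R s * δ r := fun r s => by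
    have h : r * s - algebraMap Λ R (σ r * σ s) = r * (s - algebraMap Λ R (σ s)) +
        algebraMap Λ R (σ s) * (r - algebraMap Λ R (σ r)) := by
      rw [map_mul]
      ring
    have h1 : residue R s = residue R (algebraMap Λ R (σ s)) := by
      rw [← sub_eq_zero, ← map_sub, residue_eq_zero_iff]
      exact hσ s
    rw [hδ (r * s) (σ r * σ s)
      (h ▸ add_mem (Ideal.mul_mem_left _ _ (hσ s)) (Ideal.mul_mem_left _ _ (hσ r))), h1,
      hδ r _ (hσ r), hδ s _ (hσ s)]
    have h2 : (⟨_, h ▸ add_mem (Ideal.mul_mem_left _ _ (hσ s)) (Ideal.mul_mem_left _ _ (hσ r))⟩ :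
        maximalIdeal R) = r • (⟨_, hσ s⟩ : maximalIdeal R) +
          algebraMap Λ R (σ s) • (⟨_, hσ r⟩ : maximalIdeal R) := Subtype.ext h
    refine (congrArg ℓ h2).trans ?_
    rw [map_add, map_smul, map_smul, Algebra.smul_def, Algebra.smul_def]
    rfl
  have halg : ∀ l : Λ, δ (algebraMap Λ R l) = 0 := fun l => by
    have h : algebraMap Λ R l - algebraMap Λ R l = algebraMap Λ R 0 := by simp
    rw [hδ (algebraMap Λ R l) l (by simp), ← hℓ 0 (by simp)]
    exact congrArg ℓ (Subtype.ext h)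
  refine ⟨
    { toFun := fun r => TrivSqZeroExt.inl (toResidue Λ R r) +
        TrivSqZeroExt.inr ((residueEquiv Λ R).symm (δ r))
      map_one' := ?_
      map_mul' := fun r s => ?_
      map_zero' := ?_
      map_add' := fun r s => ?_
      commutes' := fun l => ?_ }, fun m => ?_⟩
  · have := halg 1
    rw [map_one] at this
    rw [this, map_one, map_zero]
    simp
  · rw [hmul, map_mul, map_add, map_mul, map_mul, ← toResidue_apply, ← toResidue_apply]
    apply TrivSqZeroExt.ext <;> simp [mul_comm]
  · have := halg 0
    rw [map_zero] at this
    rw [this, map_zero, map_zero]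
    simp
  · rw [hadd, map_add, map_add]
    apply TrivSqZeroExt.ext <;> simp
  · rw [halg, AlgHom.commutes, map_zero]
    apply TrivSqZeroExt.ext <;> simp [TrivSqZeroExt.algebraMap_eq_inl']
  · change (TrivSqZeroExt.inl (toResidue Λ R m) +
      TrivSqZeroExt.inr ((residueEquiv Λ R).symm (δ m)) : DualNumber (ResidueField Λ)).snd = _
    have h : (m : R) - algebraMap Λ R 0 = m := by simp
    rw [hδ m 0 (h.symm ▸ m.2)]
    simp only [TrivSqZeroExt.snd_add, TrivSqZeroExt.snd_inl, TrivSqZeroExt.snd_inr, zero_add]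
    congr 2
    exact Subtype.ext h

variable (Λ R) in
/-- Elements `x_1, …, x_n` of `𝔪_R` which form a basis of the relative cotangent space
`𝔪_R ⧸ (𝔪_Λ R + 𝔪_R ^ 2)`, and tangent vectors `t_1, …, t_n : R → 𝕜[ε]` dual to them. -/
theorem exists_dual_tangent_vectors [IsNoetherianRing R] :
    ∃ (n : ℕ) (x : Fin n → R) (t : Fin n → R →ₐ[Λ] DualNumber (ResidueField Λ)),
      (∀ i, x i ∈ maximalIdeal R) ∧
      maximalIdeal R ≤ Ideal.span (Set.range x) ⊔
        (maximalIdeal Λ).map (algebraMap Λ R) ⊔ maximalIdeal R ^ 2 ∧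
      ∀ i j, (t i (x j)).snd = if i = j then 1 else 0 := by
  classical
  let L : Submodule (ResidueField R) (CotangentSpace R) :=
    Submodule.span _ {c | ∃ (l : Λ) (h : algebraMap Λ R l ∈ maximalIdeal R),
      (maximalIdeal R).toCotangent ⟨_, h⟩ = c}
  let b := Module.finBasis (ResidueField R) (CotangentSpace R ⧸ L)
  let π : maximalIdeal R →ₗ[R] CotangentSpace R ⧸ L :=
    (L.mkQ.restrictScalars R).comp (maximalIdeal R).toCotangent
  have hπ : Function.Surjective π :=
    L.mkQ_surjective.comp (maximalIdeal R).toCotangent_surjective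
  choose x hx using fun i => hπ (b i)
  have ht : ∀ i, ∃ t : R →ₐ[Λ] DualNumber (ResidueField Λ), ∀ m : maximalIdeal R,
      (t m).snd = (residueEquiv Λ R).symm (b.repr (π m) i) := fun i => by
    refine exists_algHom_dualNumber (((b.coord i).restrictScalars R).comp π) fun l h => ?_
    have : π ⟨_, h⟩ = 0 :=
      (Submodule.Quotient.mk_eq_zero L).2 (Submodule.subset_span ⟨l, h, rfl⟩)
    simp [this]
  choose t ht using ht
  have hL : ∀ c ∈ L, ∃ z : maximalIdeal R,
      (z : R) ∈ (maximalIdeal Λ).map (algebraMap Λ R) ∧ (maximalIdeal R).toCotangent z = c := by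
    intro c hc
    induction hc using Submodule.span_induction with
    | mem c hc =>
      obtain ⟨l, h, rfl⟩ := hc
      exact ⟨⟨_, h⟩, Ideal.mem_map_of_mem _ (algebraMap_mem_maximalIdeal_iff.1 h), rfl⟩
    | zero => exact ⟨0, by simp, map_zero _⟩
    | add c d _ _ hc hd =>
      obtain ⟨z, hz, rfl⟩ := hc
      obtain ⟨y, hy, rfl⟩ := hd
      exact ⟨z + y, add_mem hz hy, map_add _ _ _⟩
    | smul a c _ hc =>
      obtain ⟨z, hz, rfl⟩ := hc
      obtain ⟨a, rfl⟩ := residue_surjective a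
      exact ⟨a • z, Ideal.mul_mem_left _ _ hz, map_smul _ _ _⟩
  refine ⟨_, fun i => x i, t, fun i => (x i).2, fun m hm => ?_, fun i j => ?_⟩
  · choose a ha using fun i => residue_surjective (b.repr (π ⟨m, hm⟩) i)
    have h1 : π (⟨m, hm⟩ - ∑ i, a i • x i) = 0 := by
      rw [map_sub, map_sum, sub_eq_zero]
      conv_lhs => rw [← b.sum_repr (π ⟨m, hm⟩)]
      refine Finset.sum_congr rfl fun i _ => ?_
      rw [map_smul, hx, ← ha]
      rfl
    obtain ⟨z, hz, hz'⟩ := hL _ ((Submodule.Quotient.mk_eq_zero L).1 h1)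
    have h2 := (Ideal.toCotangent_eq _).1 hz'
    have h3 : m = (∑ i, a i * (x i : R)) + z -
        ((z : R) - ((⟨m, hm⟩ - ∑ i, a i • x i : maximalIdeal R) : R)) := by
      simp only [AddSubgroupClass.coe_sub, AddSubmonoidClass.coe_finsetSum, SetLike.val_smul,
        smul_eq_mul]
      ring
    rw [h3]
    refine sub_mem (add_mem ?_ ?_) (Ideal.mem_sup_right h2)
    · exact Ideal.mem_sup_left (Ideal.mem_sup_left (Ideal.sum_mem _ fun i _ =>
        Ideal.mul_mem_left _ _ (Ideal.subset_span ⟨i, rfl⟩)))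
    · exact Ideal.mem_sup_left (Ideal.mem_sup_right hz)
  · rw [ht, hx, b.repr_self, Finsupp.single_apply]
    simp only [eq_comm]
    split_ifs <;> simp

end presentation

/-- A hull of a functor with the tangent lifting property is a power series ring modulo an ideal
stable under the partial derivatives: the tangent vectors dual to the variables lift to derivations
`R → R ⧸ 𝔪_R ^ (N + 1)`, and these are invertible combinations of the partial derivatives. -/
theorem exists_presentation {Λ R : Type u} [CommRing Λ] [IsLocalRing Λ]
    [IsAdicComplete (maximalIdeal Λ) Λ] [CommRing R] [IsLocalRing R] [IsNoetherianRing R]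
    [IsAdicComplete (maximalIdeal R) R] [Algebra Λ R] [SameResidueField Λ R]
    {F : CategoryTheory.Functor (ArtAlg Λ) (Type w)} (hF : TangentLiftingProperty F)
    (hR : IsHull F R) :
    ∃ (n : ℕ) (φ : MvPowerSeries (Fin n) Λ →ₐ[Λ] R), Function.Surjective φ ∧
      (∀ i, φ (MvPowerSeries.X i) ∈ maximalIdeal R) ∧ DerivStable (RingHom.ker φ) := by
  classical
  obtain ⟨H⟩ := hR
  obtain ⟨n, x, t, hx, hm, ht⟩ := exists_dual_tangent_vectors Λ R
  obtain ⟨φ, hφ⟩ := exists_algHom_of_mem_radical (Λ := Λ) (maximalIdeal R) x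
    fun i => Ideal.le_radical (hx i)
  have hX : ∀ i, φ (MvPowerSeries.X i) ∈ maximalIdeal R := fun i => (hφ i).symm ▸ hx i
  refine ⟨n, φ, surjective_of_maximalIdeal_le φ hX (by simpa only [hφ] using hm), hX, ?_⟩
  intro i f hf
  rw [RingHom.mem_ker] at hf ⊢
  refine IsHausdorff.haus (I := maximalIdeal R) inferInstance _ fun N => ?_
  rw [SModEq.zero, smul_eq_mul, Ideal.mul_top]
  refine Ideal.pow_le_pow_right (Nat.le_succ N) ?_
  obtain ⟨A, v, hv⟩ : ∃ (A : ArtAlg Λ) (v : R →ₐ[Λ] A.carrier),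
      ∀ r, v r = 0 ↔ r ∈ maximalIdeal R ^ (N + 1) :=
    ⟨quotObj Λ R N, Ideal.Quotient.mkₐ Λ (maximalIdeal R ^ (N + 1)),
      fun r => Ideal.Quotient.eq_zero_iff_mem⟩
  choose v' hv' hv'' using fun k => exists_algHom_dual hF H A v (t k)
  let M : Matrix (Fin n) (Fin n) A.carrier := Matrix.of fun k j => (v' k (x j)).snd
  have hM : IsUnit M := isUnit_matrix_of_toResidue (Λ := Λ) fun k j =>
    (hv'' k (x j)).trans (ht k j)
  have hchain : M.mulVec (fun j => v (φ (MvPowerSeries.pderiv Λ j f))) = 0 := by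
    ext k
    obtain ⟨h, hh⟩ := exists_algHom_dualNumber_pderiv (v.comp φ) (M k)
    have heq : h = (v' k).comp φ := by
      refine algHom_ext_of_isNilpotent (fun j => ?_) fun j => ?_
      · rw [hh, AlgHom.comp_apply, hφ]
        apply TrivSqZeroExt.ext
        · simp [hv', hφ]
        · simp [MvPowerSeries.pderiv_X, Pi.single_apply, M, apply_ite, hφ]
      · rw [hh, TrivSqZeroExt.isNilpotent_iff_isNilpotent_fst]
        refine ⟨N + 1, ?_⟩
        simp only [TrivSqZeroExt.fst_add, TrivSqZeroExt.fst_inl, TrivSqZeroExt.fst_inr, add_zero,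
          ← map_pow]
        rw [AlgHom.comp_apply, hv, map_pow]
        exact Ideal.pow_mem_pow (hX j) _
    have h1 := congrArg TrivSqZeroExt.snd ((hh f).symm.trans (DFunLike.congr_fun heq f))
    simp only [AlgHom.comp_apply, hf, map_zero, TrivSqZeroExt.snd_add, TrivSqZeroExt.snd_inl,
      TrivSqZeroExt.snd_inr, TrivSqZeroExt.snd_zero, zero_add] at h1
    rw [Pi.zero_apply, ← h1, Matrix.mulVec, dotProduct]
    exact Finset.sum_congr rfl fun j _ => mul_comm _ _
  have h0 := Matrix.mulVec_injective_of_isUnit hM (hchain.trans (Matrix.mulVec_zero M).symm)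
  exact (hv _).1 (congrFun h0 i)

/-! ### Homomorphisms from the hull to complete rings -/

/-- If `F(Λ₁)` is nonempty for a complete `Λ₁`, there is a homomorphism `R → Λ₁`: lift
successively along `Λ₁ ⧸ 𝔪 ^ (N + 2) → Λ₁ ⧸ 𝔪 ^ (N + 1)` by smoothness, and pass to the limit. -/
theorem HullDatum.nonempty_algHom {Λ R : Type u} [CommRing Λ] [IsLocalRing Λ] [CommRing R]
    [Algebra Λ R] {F : CategoryTheory.Functor (ArtAlg Λ) (Type w)} (H : HullDatum F R)
    (Λ₁ : Type u) [CommRing Λ₁] [IsLocalRing Λ₁] [IsNoetherianRing Λ₁]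
    [IsAdicComplete (maximalIdeal Λ₁) Λ₁] [Algebra Λ Λ₁] [SameResidueField Λ Λ₁]
    (ξ : CompletedValue F Λ₁) : Nonempty (R →ₐ[Λ] Λ₁) := by
  have hle : ∀ N, maximalIdeal Λ₁ ^ (N + 1 + 1) ≤ maximalIdeal Λ₁ ^ (N + 1) := fun N =>
    Ideal.pow_le_pow_right (Nat.le_succ (N + 1))
  have step : ∀ (N : ℕ) (u : {u : R →ₐ[Λ] (quotObj Λ Λ₁ N).carrier // H.app _ u = ξ.1 N}),
      ∃ u' : {u' : R →ₐ[Λ] (quotObj Λ Λ₁ (N + 1)).carrier // H.app _ u' = ξ.1 (N + 1)},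
        ∀ r, Ideal.Quotient.factorₐ Λ (hle N) (u'.1 r) = u.1 r := by
    rintro N ⟨u, hu⟩
    obtain ⟨u', h1, h2⟩ := H.smooth (B := quotObj Λ Λ₁ (N + 1)) (A := quotObj Λ Λ₁ N)
      (Ideal.Quotient.factorₐ Λ (hle N)) (Ideal.Quotient.factor_surjective (hle N)) u (ξ.1 (N + 1))
      (hu.trans (ξ.2 N).symm)
    exact ⟨⟨u', h2⟩, fun r => DFunLike.congr_fun h1 r⟩
  choose next hnext using step
  obtain ⟨u₀, hu₀⟩ := H.exists_app_eq (quotObj Λ Λ₁ 0) (ξ.1 0)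
  let u : ∀ N, {u : R →ₐ[Λ] (quotObj Λ Λ₁ N).carrier // H.app _ u = ξ.1 N} :=
    fun N => Nat.rec ⟨u₀, hu₀⟩ next N
  let f : ∀ N : ℕ, R →ₐ[Λ] Λ₁ ⧸ maximalIdeal Λ₁ ^ (N + 1) := fun N => (u N).1
  have ha : StrictMono fun N : ℕ => N + 1 := fun _ _ h => Nat.succ_lt_succ h
  have hf : ∀ {N : ℕ}, (Ideal.Quotient.factorPow (maximalIdeal Λ₁) (ha.monotone N.le_succ)).comp
      (f (N + 1) : R →+* Λ₁ ⧸ maximalIdeal Λ₁ ^ (N + 1 + 1)) = f N := fun {N} =>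
    RingHom.ext fun r => hnext N (u N) r
  let g : R →+* Λ₁ := IsAdicComplete.StrictMono.liftRingHom (maximalIdeal Λ₁) ha
    (fun N => (f N : R →+* Λ₁ ⧸ maximalIdeal Λ₁ ^ (N + 1))) hf
  have hg : ∀ N r, Ideal.Quotient.mk (maximalIdeal Λ₁ ^ (N + 1)) (g r) = f N r := fun N r =>
    IsAdicComplete.StrictMono.mk_liftRingHom (maximalIdeal Λ₁) ha _ hf r
  refine ⟨{ g with commutes' := fun l => ?_ }⟩
  change g (algebraMap Λ R l) = algebraMap Λ Λ₁ l
  rw [← sub_eq_zero]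
  refine IsHausdorff.haus (I := maximalIdeal Λ₁) inferInstance _ fun N => ?_
  rw [SModEq.zero, smul_eq_mul, Ideal.mul_top]
  refine Ideal.pow_le_pow_right (Nat.le_succ N) ?_
  rw [← Ideal.Quotient.eq_zero_iff_mem, map_sub, sub_eq_zero, hg, AlgHom.commutes]
  rfl

theorem algHom_mem_maximalIdeal {Λ R B : Type*} [CommRing Λ] [IsLocalRing Λ] [CommRing R]
    [IsLocalRing R] [Algebra Λ R] [SameResidueField Λ R] [CommRing B] [IsLocalRing B] [Algebra Λ B]
    [SameResidueField Λ B] (v : R →ₐ[Λ] B) {r : R} (hr : r ∈ maximalIdeal R) :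
    v r ∈ maximalIdeal B := by
  obtain ⟨l, hl⟩ := exists_sub_algebraMap_mem Λ (v r)
  by_cases h : l ∈ maximalIdeal Λ
  · have := add_mem hl (algebraMap_mem_maximalIdeal_iff (R := B).2 h)
    rwa [sub_add_cancel] at this
  · have h1 : IsUnit (r - algebraMap Λ R l) := by
      by_contra h2
      have := sub_mem hr ((mem_maximalIdeal _).2 h2)
      rw [sub_sub_cancel] at this
      exact h (algebraMap_mem_maximalIdeal_iff.1 this)
    have h2 := h1.map v
    rw [map_sub, v.commutes] at h2
    exact absurd h2 ((mem_maximalIdeal _).1 hl)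

/-- The ideal of elements of a commutative ring which are torsion for its additive group. -/
def addTorsionIdeal (A : Type*) [CommRing A] : Ideal A where
  carrier := {x | ∃ m : ℕ, m ≠ 0 ∧ m • x = 0}
  add_mem' := by
    rintro x y ⟨m, hm, hx⟩ ⟨k, hk, hy⟩
    refine ⟨m * k, mul_ne_zero hm hk, ?_⟩
    rw [smul_add, mul_comm m k, mul_smul, hx, mul_comm k m, mul_smul, hy, smul_zero, smul_zero,
      add_zero]
  zero_mem' := ⟨1, one_ne_zero, smul_zero _⟩
  smul_mem' := by
    rintro a x ⟨m, hm, hx⟩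
    exact ⟨m, hm, by rw [smul_comm, hx, smul_zero]⟩

instance isAddTorsionFree_quotient_addTorsionIdeal (A : Type*) [CommRing A] :
    IsAddTorsionFree (A ⧸ addTorsionIdeal A) where
  nsmul_right_injective k hk := by
    intro x y hxy
    obtain ⟨x, rfl⟩ := Ideal.Quotient.mk_surjective x
    obtain ⟨y, rfl⟩ := Ideal.Quotient.mk_surjective y
    have h1 : k • Ideal.Quotient.mk (addTorsionIdeal A) x =
      k • Ideal.Quotient.mk (addTorsionIdeal A) y := hxy
    rw [← map_nsmul, ← map_nsmul, Ideal.Quotient.mk_eq_mk_iff_sub_mem, ← smul_sub] at h1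
    obtain ⟨m, hm, h⟩ := h1
    rw [Ideal.Quotient.mk_eq_mk_iff_sub_mem]
    exact ⟨m * k, mul_ne_zero hm hk, by rw [mul_smul, h]⟩

/-! ### Formal smoothness and equations of the hull -/

section cases

variable {Λ R : Type*} [CommRing Λ] [CommRing R] [Algebra Λ R] {n : ℕ}
  {φ : MvPowerSeries (Fin n) Λ →ₐ[Λ] R}

theorem algebraMap_coeff_eq_zero_of_rat [IsLocalRing R] [IsNoetherianRing R] (q : ℚ →+* Λ)
    (hX : ∀ i, φ (MvPowerSeries.X i) ∈ maximalIdeal R) (hstab : DerivStable (RingHom.ker φ))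
    (f : MvPowerSeries (Fin n) Λ) (hf : φ f = 0) (d : Fin n →₀ ℕ) :
    algebraMap Λ R (MvPowerSeries.coeff d f) = 0 := by
  let : Algebra ℚ R := ((algebraMap Λ R).comp q).toAlgebra
  have : IsAddTorsionFree R := .of_module_rat R
  exact hstab.algebraMap_coeff_eq_zero (maximalIdeal R) φ hX (fun _ h => h) hf d

/-- The torsion of `Λ₁` is divided out so that the composite `Λ⟦X⟧ → R → Λ₁` becomes a homomorphism
to a torsion-free ring; `Λ` remains a subring. -/
theorem coeff_eq_zero_of_algHom [IsLocalRing Λ] [IsLocalRing R] [SameResidueField Λ R]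
    [IsAddTorsionFree Λ] {Λ₁ : Type*}
    [CommRing Λ₁] [IsLocalRing Λ₁] [IsNoetherianRing Λ₁] [Algebra Λ Λ₁] [SameResidueField Λ Λ₁]
    (hinj : Function.Injective (algebraMap Λ Λ₁)) (v : R →ₐ[Λ] Λ₁)
    (hX : ∀ i, φ (MvPowerSeries.X i) ∈ maximalIdeal R) (hstab : DerivStable (RingHom.ker φ))
    (f : MvPowerSeries (Fin n) Λ) (hf : φ f = 0) (d : Fin n →₀ ℕ) :
    MvPowerSeries.coeff d f = 0 := by
  have hmem : ∀ l : Λ, algebraMap Λ Λ₁ l ∈ addTorsionIdeal Λ₁ → l = 0 := by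
    rintro l ⟨m, hm, h⟩
    rw [← map_nsmul, ← map_zero (algebraMap Λ Λ₁)] at h
    exact (smul_eq_zero_iff_right hm).1 (hinj h)
  have : Nontrivial (Λ₁ ⧸ addTorsionIdeal Λ₁) := Ideal.Quotient.nontrivial_iff.2 fun h =>
    one_ne_zero (hmem 1 (by rw [h]; trivial))
  have : IsLocalRing (Λ₁ ⧸ addTorsionIdeal Λ₁) :=
    .of_surjective' (Ideal.Quotient.mk _) Ideal.Quotient.mk_surjective
  have : SameResidueField Λ (Λ₁ ⧸ addTorsionIdeal Λ₁) := sameResidueField_of_surjective Λ Λ₁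
    (Ideal.Quotient.mkₐ Λ _) (Ideal.Quotient.mkₐ_surjective Λ _)
  let w : R →ₐ[Λ] Λ₁ ⧸ addTorsionIdeal Λ₁ := (Ideal.Quotient.mkₐ Λ _).comp v
  refine hmem _ (Ideal.Quotient.eq_zero_iff_mem.1 ?_)
  refine hstab.algebraMap_coeff_eq_zero (maximalIdeal (Λ₁ ⧸ addTorsionIdeal Λ₁)) (w.comp φ)
    (fun i => algHom_mem_maximalIdeal w (hX i)) (fun g hg => ?_) hf d
  rw [RingHom.mem_ker] at hg
  rw [AlgHom.comp_apply, hg, map_zero]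

theorem exists_quotient_span_subst (p : ℕ) [Fact p.Prime] [CharP Λ p] [IsNoetherianRing Λ]
    (hΛ : IsField Λ) [Nontrivial R] (hφ : Function.Surjective φ)
    (hstab : DerivStable (RingHom.ker φ)) :
    ∃ (r : ℕ) (f g : Fin r → MvPowerSeries (Fin n) Λ),
      (∀ i, MvPowerSeries.constantCoeff (f i) = 0) ∧
      (∀ i, f i = MvPowerSeries.subst
        (fun j => (MvPowerSeries.X j : MvPowerSeries (Fin n) Λ) ^ p) (g i)) ∧
      Nonempty (R ≃ₐ[Λ] (MvPowerSeries (Fin n) Λ ⧸ Ideal.span (Set.range f))) := by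
  have hp : p ≠ 0 := (Fact.out : p.Prime).ne_zero
  obtain ⟨r, g, hg⟩ := hstab.exists_eq_span_expand p hp hΛ
  refine ⟨r, fun i => MvPowerSeries.expand p hp (g i), g, fun i => ?_, fun i => ?_, ⟨?_⟩⟩
  · by_contra h
    obtain ⟨u, hu⟩ := hΛ.mul_inv_cancel h
    have h1 : MvPowerSeries.expand p hp (g i) ∈ RingHom.ker φ :=
      hg ▸ Ideal.subset_span ⟨i, rfl⟩
    exact RingHom.ker_ne_top φ ((RingHom.ker φ).eq_top_of_isUnit_mem h1
      (MvPowerSeries.isUnit_iff_constantCoeff.2 (IsUnit.of_mul_eq_one u hu)))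
  · exact MvPowerSeries.substAlgHom_apply _ _
  · exact (Ideal.quotientKerAlgEquivOfSurjective hφ).symm.trans
      (Ideal.quotientEquivAlgOfEq Λ hg)

/-- The ideal of the power series whose image in `R` vanishes at all generic points of `Spec R` is
derivative-stable, proper, and radical because `R` is generically reduced; hence it is zero. -/
theorem injective_of_genericallyReduced [Nontrivial R] (p : ℕ) [Fact p.Prime] [CharP Λ p]
    (hΛ : IsField Λ) [PerfectRing Λ p] (hred : GenericallyReduced R) (hφ : Function.Surjective φ)
    (hstab : DerivStable (RingHom.ker φ)) (f : MvPowerSeries (Fin n) Λ) (hf : φ f = 0) :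
    f = 0 := by
  let K : Ideal (MvPowerSeries (Fin n) Λ) :=
    { carrier := {f | ∀ P ∈ minimalPrimes R, ∃ s ∉ P, s * φ f = 0}
      add_mem' := fun {f g} hf hg P hP => by
        obtain ⟨s, hs, hsf⟩ := hf P hP
        obtain ⟨t, ht, htg⟩ := hg P hP
        refine ⟨s * t, hP.1.1.mul_notMem hs ht, ?_⟩
        rw [map_add]
        linear_combination t * hsf + s * htg
      zero_mem' := fun P hP => ⟨1, fun h => hP.1.1.ne_top ((Ideal.eq_top_iff_one P).2 h), by simp⟩
      smul_mem' := fun a f hf P hP => by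
        obtain ⟨s, hs, hsf⟩ := hf P hP
        refine ⟨s, hs, ?_⟩
        rw [smul_eq_mul, map_mul]
        linear_combination φ a * hsf }
  have hK : ∀ f, f ∈ K ↔ ∀ P ∈ minimalPrimes R, ∃ s ∉ P, s * φ f = 0 := fun f => Iff.rfl
  have hKstab : DerivStable K := by
    intro i f hf P hP
    obtain ⟨s, hs, hsf⟩ := hf P hP
    obtain ⟨g, rfl⟩ := hφ s
    -- differentiate `g * f ∈ ker φ` and multiply by `g` to get rid of the term `∂g * f`
    have h1 := hstab i (g * f) (by rw [RingHom.mem_ker, map_mul, hsf])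
    rw [RingHom.mem_ker, Derivation.leibniz, map_add, smul_eq_mul, smul_eq_mul, map_mul,
      map_mul] at h1
    refine ⟨φ g * φ g, hP.1.1.mul_notMem hs hs, ?_⟩
    linear_combination φ g * h1 - φ (MvPowerSeries.pderiv Λ i g) * hsf
  have hKrad : K.IsRadical := by
    rintro f ⟨m, hm⟩ P hP
    have : P.IsPrime := hP.1.1
    have := hred P hP
    obtain ⟨s, hs, hsf⟩ := hm P hP
    have h1 : algebraMap R (Localization.AtPrime P) (φ f) ^ m = 0 := by
      rw [← map_pow, IsLocalization.map_eq_zero_iff P.primeCompl]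
      exact ⟨⟨s, hs⟩, by simpa using hsf⟩
    obtain ⟨t, ht⟩ := (IsLocalization.map_eq_zero_iff P.primeCompl _ _).1
      (IsReduced.eq_zero _ ⟨m, h1⟩)
    exact ⟨t, t.2, ht⟩
  have hKtop : K ≠ ⊤ := by
    intro h
    obtain ⟨M, hM⟩ := Ideal.exists_maximal R
    obtain ⟨P, hP, -⟩ := Ideal.exists_minimalPrimes_le (I := (⊥ : Ideal R)) (J := M) bot_le
    obtain ⟨s, hs, hs1⟩ := (hK 1).1 (h ▸ Submodule.mem_top) P hP
    rw [map_one, mul_one] at hs1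
    exact hs (hs1 ▸ P.zero_mem)
  have h0 := hKstab.eq_bot_of_isRadical p hΛ hKrad hKtop
  have h1 : f ∈ K := fun P hP =>
    ⟨1, fun h => hP.1.1.ne_top ((Ideal.eq_top_iff_one P).2 h), by simp [hf]⟩
  rwa [h0, Ideal.mem_bot] at h1

end cases

end TangentLifting

theorem theoremA
    {Λ : Type u} [CommRing Λ] [IsLocalRing Λ] [IsNoetherianRing Λ]
    [IsAdicComplete (IsLocalRing.maximalIdeal Λ) Λ]
    (F : CategoryTheory.Functor (TangentLifting.ArtAlg Λ) (Type w))
    (hF : TangentLifting.TangentLiftingProperty F)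
    (R : Type u) [CommRing R] [IsLocalRing R] [IsNoetherianRing R]
    [IsAdicComplete (IsLocalRing.maximalIdeal R) R]
    [Algebra Λ R] [TangentLifting.SameResidueField Λ R]
    (hR : TangentLifting.IsHull F R) :
    -- `Λ ⊇ ℚ`: `R` is smooth over the image of `Λ`, hence over `Λ` if `Λ → R` is injective
    (Nonempty (ℚ →+* Λ) →
      TangentLifting.AdicFormallySmooth (algebraMap Λ R).range R ∧
      (Function.Injective (algebraMap Λ R) → TangentLifting.AdicFormallySmooth Λ R)) ∧
    -- `Λ = 𝕜` a field of characteristic `p > 0`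
    (∀ (p : ℕ) [Fact p.Prime] [CharP Λ p], IsField Λ →
      (∃ (n r : ℕ) (f g : Fin r → MvPowerSeries (Fin n) Λ),
        (∀ i, MvPowerSeries.constantCoeff (f i) = 0) ∧
        (∀ i, f i = MvPowerSeries.subst
          (fun j => (MvPowerSeries.X j : MvPowerSeries (Fin n) Λ) ^ p) (g i)) ∧
        Nonempty (R ≃ₐ[Λ] (MvPowerSeries (Fin n) Λ ⧸ Ideal.span (Set.range f)))) ∧
      (PerfectRing Λ p → TangentLifting.GenericallyReduced R →
        TangentLifting.AdicFormallySmooth Λ R)) ∧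
    -- `Λ` torsion-free
    (IsAddTorsionFree Λ →
      ∀ (Λ₁ : Type u) [CommRing Λ₁] [IsLocalRing Λ₁] [IsNoetherianRing Λ₁]
        [IsAdicComplete (IsLocalRing.maximalIdeal Λ₁) Λ₁]
        [Algebra Λ Λ₁] [TangentLifting.SameResidueField Λ Λ₁],
        Function.Injective (algebraMap Λ Λ₁) →
        Nonempty (TangentLifting.CompletedValue F Λ₁) →
        TangentLifting.AdicFormallySmooth Λ R) := by
  obtain ⟨n, φ, hφ, hX, hstab⟩ := TangentLifting.exists_presentation hF hR
  refine ⟨fun ⟨q⟩ => ?_, fun p _ _ hΛ => ⟨?_, fun _ hred => ?_⟩,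
    fun _ Λ₁ _ _ _ _ _ _ hinj ⟨ξ⟩ => ?_⟩
  · have hcoeff := TangentLifting.algebraMap_coeff_eq_zero_of_rat q hX hstab
    refine ⟨?_, fun hinj => ?_⟩
    · let : Algebra Λ (algebraMap Λ R).range := (algebraMap Λ R).rangeRestrict.toAlgebra
      have : IsScalarTower Λ (algebraMap Λ R).range R := .of_algebraMap_eq fun _ => rfl
      exact TangentLifting.adicFormallySmooth_of_presentation
        (algebraMap Λ R).rangeRestrict_surjective φ hφ hX
        fun f hf d => Subtype.ext (hcoeff f hf d)
    · exact TangentLifting.adicFormallySmooth_of_presentation Function.surjective_id φ hφ hX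
        fun f hf d => hinj ((hcoeff f hf d).trans (map_zero _).symm)
  · exact ⟨n, TangentLifting.exists_quotient_span_subst p hΛ hφ hstab⟩
  · refine TangentLifting.adicFormallySmooth_of_presentation Function.surjective_id φ hφ hX
      fun f hf d => ?_
    rw [TangentLifting.injective_of_genericallyReduced p hΛ hred hφ hstab f hf, map_zero, map_zero]
  · obtain ⟨H⟩ := hR
    obtain ⟨v⟩ := H.nonempty_algHom Λ₁ ξ
    exact TangentLifting.adicFormallySmooth_of_presentation Function.surjective_id φ hφ hX
      (TangentLifting.coeff_eq_zero_of_algHom hinj v hX hstab)
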